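/- Let $n\ge 0$ and identify Radon measures on $\mathbb{R}^{n+1}$ with locally finite Borel measures. For a Radon measure $\mu$ on $\mathbb{R}^{n+1}$ and $a\in\mathbb{R}^{n+1}$, let $\mathrm{Tan}(\mu,a)$ be the set of non-zero Radon measures $\nu$ for which there are $c_i>0$ and $r_i>0$ with $r_i\to 0$ such that $c_i\,T_{a,r_i}[\mu]\to\nu$ weakly (against continuous functions with compact support), where $T_{a,r}(x)=(x-a)/r$ and $T_{a,r}[\mu]$ is the push-forward of $\mu$. For a harmonic polynomial $h$ on $\mathbb{R}^{n+1}$ with $h(0)=0$ put $$d\omega_h=-\nu_{\{h>0\}}\cdot\nabla h\;d\sigma_{\{h=0\}},$$ where $\nu_{\{h>0\}}$ is the measure theoretic unit outward normal of $\{h>0\}$ and $\sigma_{\{h=0\}}$ is the surface measure ($n$-dimensional Hausdorff measure) on $\{h=0\}$. Let $\mathscr{P}(k)$ be the set of all $\omega_h$, $h$ a harmonic polynomial of degree at most $k$ with $h(0)=0$, and let $\mathscr{F}(k)$ be the set of all $\omega_h$, $h$ a harmonic polynomial with $h(0)=0$ that is homogeneous of degree $k$. Let $\omega$ be any Radon measure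 on $\mathbb{R}^{n+1}$ and let $\xi\in\mathbb{R}^{n+1}$ be such that $\mathrm{Tan}(\omega,\xi)\subset\mathscr{P}(k)$ for some integer $k\ge 0$. Then: 1. if $m\geq 0$ is any integer with $\mathrm{Tan}(\omega,\xi)\cap\mathscr{F}(m)\neq\varnothing$, then $\mathrm{Tan}(\omega,\xi)\subset\mathscr{F}(m)$; 2. there is an integer $0\le m\le k$ with $\mathrm{Tan}(\omega,\xi)\subset\mathscr{F}(m)$; that is, all tangent measures of $\omega$ at $\xi$ come from homogeneous harmonic polynomials of one single degree. -/

import Mathlib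

open MeasureTheory Filter Topology

noncomputable section

namespace HarmonicBlowup

/-- The ambient space `ℝ^{n+1}` with its Euclidean structure. -/
abbrev Space (n : ℕ) : Type := EuclideanSpace ℝ (Fin (n + 1))

/-- The map `T_{a,r}(x) = (x - a) / r`. -/
def zoom {n : ℕ} (a : Space n) (r : ℝ) (x : Space n) : Space n := r⁻¹ • (x - a)

/-- Weak convergence of Radon measures: convergence of the integrals of all continuous functions
with compact support. -/
def WeakTendsto {n : ℕ} (μ : ℕ → Measure (Space n)) (ν : Measure (Space n)) : Prop :=
  ∀ φ : Space n → ℝ, Continuous φ → HasCompactSupport φ →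
    Tendsto (fun i => ∫ x, φ x ∂(μ i)) atTop (𝓝 (∫ x, φ x ∂ν))

/-- `Tan(μ, a)`: the non-zero Radon measures `ν` that are weak limits of `c i • T_{a, r i}[μ]`
for some `c i > 0` and some `r i > 0` tending to `0`.
(A Borel measure on `ℝ^{n+1}` is Radon exactly when it is locally finite.) -/
def Tan {n : ℕ} (μ : Measure (Space n)) (a : Space n) : Set (Measure (Space n)) :=
  {ν | ν ≠ 0 ∧ IsLocallyFiniteMeasure ν ∧
    ∃ c r : ℕ → ℝ, (∀ i, 0 < c i) ∧ (∀ i, 0 < r i) ∧ Tendsto r atTop (𝓝 0) ∧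
      WeakTendsto (fun i => ENNReal.ofReal (c i) • μ.map (zoom a (r i))) ν}

/-- `ν` is a measure theoretic unit outward normal of `S` at `x`: up to sets of density zero at `x`,
the set `S` is the half space `{y | ⟪y - x, ν⟫ < 0}` near `x`. -/
def IsOuterNormal {n : ℕ} (S : Set (Space n)) (x ν : Space n) : Prop :=
  ‖ν‖ = 1 ∧
  Tendsto (fun r : ℝ =>
      (volume {y ∈ Metric.ball x r | y ∈ S ∧ 0 < inner ℝ (y - x) ν}).toReal / r ^ (n + 1))
    (𝓝[>] 0) (𝓝 0) ∧
  Tendsto (fun r : ℝ =>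
      (volume {y ∈ Metric.ball x r | y ∉ S ∧ inner ℝ (y - x) ν < 0}).toReal / r ^ (n + 1))
    (𝓝[>] 0) (𝓝 0)

open Classical in
/-- The measure theoretic unit outward normal `ν_S(x)`; it is set to `0` at the points `x` where
there is none (there is at most one). -/
def outerNormal {n : ℕ} (S : Set (Space n)) (x : Space n) : Space n :=
  if hx : ∃ ν, IsOuterNormal S x ν then hx.choose else 0

/-- The measure `ω_h = -(ν_{Ω_h} · ∇h) dσ_{Σ_h}`, where `Ω_h = {h > 0}`, `Σ_h = {h = 0}`, and
`σ_{Σ_h}` is the surface measure on `Σ_h`, i.e. the `n`-dimensional Hausdorff measure (normalized so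
that it is Lebesgue measure on `n`-planes) restricted to `Σ_h`. -/
def omega {n : ℕ} (h : Space n → ℝ) : Measure (Space n) :=
  ((μHE[n] : Measure (Space n)).restrict {x | h x = 0}).withDensity
    (fun x => ENNReal.ofReal (-inner ℝ (outerNormal {y | 0 < h y} x) (gradient h x)))

/-- The function on `ℝ^{n+1}` given by a polynomial in `n + 1` variables. -/
def polyFun {n : ℕ} (p : MvPolynomial (Fin (n + 1)) ℝ) (x : Space n) : ℝ :=
  MvPolynomial.eval (fun i => x i) p

/-- `p` is a harmonic polynomial that vanishes at the origin. -/
def IsHarmonicPoly {n : ℕ} (p : MvPolynomial (Fin (n + 1)) ℝ) : Prop :=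
  InnerProductSpace.HarmonicOnNhd (polyFun p) Set.univ ∧ polyFun p 0 = 0

/-- `𝒫(k)`: the measures `ω_h` of the harmonic polynomials `h` of degree at most `k` with
`h(0) = 0`. -/
def PolyCone (n k : ℕ) : Set (Measure (Space n)) :=
  {μ | ∃ p : MvPolynomial (Fin (n + 1)) ℝ,
    IsHarmonicPoly p ∧ p.totalDegree ≤ k ∧ μ = omega (polyFun p)}

/-- `ℱ(k)`: the measures `ω_h` of the harmonic polynomials `h` with `h(0) = 0` that are homogeneous
of degree `k`. -/
def HomogCone (n k : ℕ) : Set (Measure (Space n)) :=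
  {μ | ∃ p : MvPolynomial (Fin (n + 1)) ℝ,
    IsHarmonicPoly p ∧ p.IsHomogeneous k ∧ μ = omega (polyFun p)}

end HarmonicBlowup

end

/-! The growth of the mass of `ω_p` around the origin remembers the degrees occurring in `p`. For a
nonzero harmonic polynomial `p`, `omega (polyFun p)` is half the distributional Laplacian of `|p|`:
`∫ φ dω_p = -½ ∫ sign(p) ⟪∇p, ∇φ⟫` (`IsHarmonicPoly.lintegral_omega_eq_halfLapAbs`). If `φ` is a
radial bump at scale `t`, the right side contains only the radial derivative of `p`, which by
Euler's identity is the sum of the homogeneous components weighted by their degrees. The top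
component governs it as `t → ∞`, the lowest one as `t → 0`. So the doubling ratio of the smoothed
mass tends to `2^(n-1+b)`, with `b` the total degree at infinity
(`IsHarmonicPoly.massProfile_atTop`) and the lowest degree at zero
(`IsHarmonicPoly.massProfile_nhdsGT`). For homogeneous `p` it is constant
(`IsHarmonicPoly.massProfile_two_mul`).

The Green formula is proved first near regular points, where `{p = 0}` is nearly flat and surface
measure can be compared with Lebesgue measure on a hyperplane up to a factor close to one. A
partition of unity makes the factor disappear, and cutoffs in `‖∇p‖²` then remove the critical set.

The rest is a connectedness argument in the style of Preiss. Let `m` be the least lowest degree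
among the polynomials of tangent measures, and suppose that some tangent measure has total degree
above `m`. Take `c` strictly between the doubling rates of `m` and `m + 1`. Along the blow-ups to
the minimal measure the profile of `ω` has ratio below `c`, yet at arbitrarily small scales it has
ratio above `c`. Blowing up at the last crossing gives a tangent measure with ratio `c` at scale one
and at most `c` at larger scales (`exists_mem_Tan_doubling_eq`). Its total degree is at most `m` and
its lowest degree at least `m`, so it is homogeneous and its ratio is the rate of `m`, not `c`.
Hence every tangent measure is homogeneous of degree `m`. Since the rate is injective in the degree,
a nonzero measure lies in only one `HomogCone`, which gives the first claim. -/

namespace HarmonicBlowup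

/-! ### Polynomial functions: gradient, Euler's identity, null zero sets -/

open MvPolynomial

variable {n : ℕ}

/-- The gradient of the polynomial function of `p`, written with the formal partial derivatives. -/
noncomputable def gradVec (p : MvPolynomial (Fin (n + 1)) ℝ) (x : Space n) : Space n :=
  WithLp.toLp 2 fun i => polyFun (pderiv i p) x

@[simp] lemma gradVec_apply (p : MvPolynomial (Fin (n + 1)) ℝ) (x : Space n) (i : Fin (n + 1)) :
    gradVec p x i = polyFun (pderiv i p) x := rfl

lemma polyFun_add (p q : MvPolynomial (Fin (n + 1)) ℝ) (x : Space n) :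
    polyFun (p + q) x = polyFun p x + polyFun q x := by simp [polyFun]

lemma polyFun_mul (p q : MvPolynomial (Fin (n + 1)) ℝ) (x : Space n) :
    polyFun (p * q) x = polyFun p x * polyFun q x := by simp [polyFun]

lemma polyFun_sum {ι : Type*} (s : Finset ι) (p : ι → MvPolynomial (Fin (n + 1)) ℝ) (x : Space n) :
    polyFun (∑ j ∈ s, p j) x = ∑ j ∈ s, polyFun (p j) x := by simp [polyFun]

lemma inner_gradVec (p : MvPolynomial (Fin (n + 1)) ℝ) (x v : Space n) :
    inner ℝ (gradVec p x) v = ∑ i, polyFun (pderiv i p) x * v i := by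
  simp [PiLp.inner_apply, mul_comm]

lemma gradVec_add (p q : MvPolynomial (Fin (n + 1)) ℝ) (x : Space n) :
    gradVec (p + q) x = gradVec p x + gradVec q x := by
  ext i; simp [polyFun_add]

lemma gradVec_mul (p q : MvPolynomial (Fin (n + 1)) ℝ) (x : Space n) :
    gradVec (p * q) x = polyFun p x • gradVec q x + polyFun q x • gradVec p x := by
  ext i; simp [polyFun_mul, polyFun_add]

lemma hasFDerivAt_polyFun (p : MvPolynomial (Fin (n + 1)) ℝ) (x : Space n) :
    HasFDerivAt (polyFun p) (innerSL ℝ (gradVec p x)) x := by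
  induction p using MvPolynomial.induction_on with
  | C a =>
    have h1 : polyFun (C a : MvPolynomial (Fin (n + 1)) ℝ) = fun _ => a := by
      ext y; simp [polyFun]
    have h2 : gradVec (C a : MvPolynomial (Fin (n + 1)) ℝ) x = 0 := by
      ext i; simp [polyFun]
    rw [h1, h2, map_zero]
    exact hasFDerivAt_const a x
  | add p q hp hq =>
    have h1 : polyFun (p + q) = fun y => polyFun p y + polyFun q y := by
      ext y; exact polyFun_add p q y
    rw [h1, gradVec_add, map_add]
    exact hp.add hq
  | mul_X p i hp =>
    have h1 : polyFun (p * X i) = fun y => polyFun p y * y i := by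
      ext y; simp [polyFun]
    have h2 : gradVec (X i : MvPolynomial (Fin (n + 1)) ℝ) x = EuclideanSpace.single i 1 := by
      ext j
      by_cases hj : j = i
      · subst hj; simp [polyFun]
      · simp [polyFun, pderiv_X, hj, Ne.symm hj]
    have h3 : HasFDerivAt (fun y : Space n => y i) (innerSL ℝ (EuclideanSpace.single i (1 : ℝ))) x := by
      have h4 : (fun y : Space n => y i) = innerSL ℝ (EuclideanSpace.single i (1 : ℝ)) := by
        ext y; simp [EuclideanSpace.inner_single_left]
      rw [h4]
      exact (innerSL ℝ (EuclideanSpace.single i (1 : ℝ))).hasFDerivAt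
    rw [h1, gradVec_mul, h2]
    have := hp.mul h3
    convert! this using 1
    simp [polyFun]

lemma contDiff_polyFun (p : MvPolynomial (Fin (n + 1)) ℝ) {m : WithTop ℕ∞} :
    ContDiff ℝ m (polyFun p) := by
  induction p using MvPolynomial.induction_on with
  | C a => 
    have h1 : polyFun (C a : MvPolynomial (Fin (n + 1)) ℝ) = fun _ => a := by
      ext y; simp [polyFun]
    rw [h1]; exact contDiff_const
  | add p q hp hq =>
    have h1 : polyFun (p + q) = fun y => polyFun p y + polyFun q y := by
      ext y; exact polyFun_add p q y
    rw [h1]; exact hp.add hq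
  | mul_X p i hp =>
    have h1 : polyFun (p * X i) = fun y => polyFun p y * y i := by
      ext y; simp [polyFun]
    rw [h1]
    exact hp.mul (by fun_prop)

@[fun_prop] lemma continuous_polyFun (p : MvPolynomial (Fin (n + 1)) ℝ) : Continuous (polyFun p) :=
  (contDiff_polyFun p (m := 0)).continuous

lemma fderiv_polyFun (p : MvPolynomial (Fin (n + 1)) ℝ) (x v : Space n) :
    fderiv ℝ (polyFun p) x v = inner ℝ (gradVec p x) v := by
  rw [(hasFDerivAt_polyFun p x).fderiv, innerSL_apply_apply]

lemma gradient_polyFun (p : MvPolynomial (Fin (n + 1)) ℝ) (x : Space n) :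
    gradient (polyFun p) x = gradVec p x := by
  apply HasGradientAt.gradient
  rw [hasGradientAt_iff_hasFDerivAt]
  exact hasFDerivAt_polyFun p x

lemma contDiff_gradVec (p : MvPolynomial (Fin (n + 1)) ℝ) {m : WithTop ℕ∞} :
    ContDiff ℝ m (gradVec p) := by
  rw [contDiff_euclidean]
  exact fun i => contDiff_polyFun _

@[fun_prop] lemma continuous_gradVec (p : MvPolynomial (Fin (n + 1)) ℝ) : Continuous (gradVec p) :=
  (contDiff_gradVec p (m := 0)).continuous

/-- Puts harmonicity in terms of formal partial derivatives. This is what removes the second-order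
term from the divergence of `φ ∇p`. -/
lemma IsHarmonicPoly.sum_pderiv_pderiv {p : MvPolynomial (Fin (n + 1)) ℝ} (hp : IsHarmonicPoly p)
    (x : Space n) : ∑ i, polyFun (pderiv i (pderiv i p)) x = 0 := by
  have h := (hp.1 x (Set.mem_univ x)).2.self_of_nhds
  rw [InnerProductSpace.laplacian_eq_iteratedFDeriv_orthonormalBasis _
    (EuclideanSpace.basisFun (Fin (n + 1)) ℝ)] at h
  simp only [Pi.zero_apply] at h
  rw [← h]
  refine Finset.sum_congr rfl fun i _ => ?_
  rw [iteratedFDeriv_two_apply]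
  simp only [Matrix.cons_val_zero, Matrix.cons_val_one, EuclideanSpace.basisFun_apply]
  have h1 : fderiv ℝ (polyFun p) = fun y => innerSL ℝ (gradVec p y) := by
    ext1 y; exact (hasFDerivAt_polyFun p y).fderiv
  have h2 : HasFDerivAt (fun y => innerSL ℝ (gradVec p y))
      ((innerSL ℝ).comp (fderiv ℝ (gradVec p) x)) x :=
    (innerSL ℝ).hasFDerivAt.comp x
      ((contDiff_gradVec p (m := 1)).differentiable one_ne_zero x).hasFDerivAt
  have h3 : HasFDerivAt (fun y : Space n => (gradVec p y) i)
      ((EuclideanSpace.proj i : Space n →L[ℝ] ℝ).comp (fderiv ℝ (gradVec p) x)) x :=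
    (EuclideanSpace.proj i : Space n →L[ℝ] ℝ).hasFDerivAt.comp x
      ((contDiff_gradVec p (m := 1)).differentiable one_ne_zero x).hasFDerivAt
  have h4 := h3.unique (hasFDerivAt_polyFun (pderiv i p) x)
  have h5 := congrArg (fun f => f (EuclideanSpace.single i (1 : ℝ))) h4
  rw [h1, h2.fderiv]
  simp only [ContinuousLinearMap.comp_apply, PiLp.proj_apply, innerSL_apply_apply,
    EuclideanSpace.inner_single_right] at h5 ⊢
  simpa using h5.symm

lemma polyFun_smul_of_isHomogeneous {p : MvPolynomial (Fin (n + 1)) ℝ} {k : ℕ}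
    (hp : p.IsHomogeneous k) (t : ℝ) (x : Space n) : polyFun p (t • x) = t ^ k * polyFun p x := by
  simp only [polyFun, eval_eq]
  rw [Finset.mul_sum]
  refine Finset.sum_congr rfl fun d hd => ?_
  have h := hp.degree_eq_sum_deg_support hd
  simp only [PiLp.smul_apply, smul_eq_mul, mul_pow, Finset.prod_mul_distrib,
    Finset.prod_pow_eq_pow_sum]
  rw [h]; ring

/-- Euler's identity, the source of the degree factor in the flux through radial bumps. -/
lemma inner_gradVec_of_isHomogeneous {p : MvPolynomial (Fin (n + 1)) ℝ} {k : ℕ}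
    (hp : p.IsHomogeneous k) (x : Space n) : inner ℝ (gradVec p x) x = k * polyFun p x := by
  have h := congrArg (fun q => polyFun q x) hp.sum_X_mul_pderiv
  simp only [polyFun_sum, polyFun_mul] at h
  rw [inner_gradVec]
  simpa [polyFun, mul_comm] using h

lemma polyFun_eq_sum (p : MvPolynomial (Fin (n + 1)) ℝ) (x : Space n) :
    polyFun p x = ∑ j ∈ Finset.range (p.totalDegree + 1),
      polyFun (homogeneousComponent j p) x := by
  rw [← polyFun_sum, sum_homogeneousComponent]

lemma polyFun_smul (p : MvPolynomial (Fin (n + 1)) ℝ) (t : ℝ) (x : Space n) :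
    polyFun p (t • x) = ∑ j ∈ Finset.range (p.totalDegree + 1),
      t ^ j * polyFun (homogeneousComponent j p) x := by
  rw [polyFun_eq_sum]
  exact Finset.sum_congr rfl fun j _ =>
    polyFun_smul_of_isHomogeneous (homogeneousComponent_isHomogeneous j p) t x

lemma gradVec_sum {ι : Type*} (s : Finset ι) (p : ι → MvPolynomial (Fin (n + 1)) ℝ)
    (x : Space n) : gradVec (∑ j ∈ s, p j) x = ∑ j ∈ s, gradVec (p j) x := by
  ext i; simp [polyFun_sum]

lemma inner_gradVec_smul (p : MvPolynomial (Fin (n + 1)) ℝ) (t : ℝ) (x : Space n) :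
    inner ℝ (gradVec p (t • x)) (t • x) = ∑ j ∈ Finset.range (p.totalDegree + 1),
      j * (t ^ j * polyFun (homogeneousComponent j p) x) := by
  conv_lhs => rw [← sum_homogeneousComponent p, gradVec_sum, sum_inner]
  refine Finset.sum_congr rfl fun j _ => ?_
  rw [inner_gradVec_of_isHomogeneous (homogeneousComponent_isHomogeneous j p),
    polyFun_smul_of_isHomogeneous (homogeneousComponent_isHomogeneous j p)]

/-- Fubini and induction on the number of variables: as a polynomial in the first variable, `p` has
a leading coefficient that is nonzero for almost every value of the others, and then only finitely
many roots. -/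
lemma volume_eval_eq_zero (m : ℕ) (p : MvPolynomial (Fin m) ℝ) (hp : p ≠ 0) :
    volume {x : Fin m → ℝ | eval x p = 0} = 0 := by
  induction m with
  | zero =>
    have : {x : Fin 0 → ℝ | eval x p = 0} = ∅ := by
      ext x
      simp only [Set.mem_ofPred_eq, Set.mem_empty_iff_false, iff_false]
      intro hx
      apply hp
      apply MvPolynomial.funext
      intro y
      rw [Subsingleton.elim y x, hx, map_zero]
    simp [this]
  | succ m ih =>
    have hmeas : MeasurableSet {x : Fin (m + 1) → ℝ | eval x p = 0} :=
      (isClosed_singleton.preimage (MvPolynomial.continuous_eval p)).measurableSet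
    have hq : finSuccEquiv ℝ m p ≠ 0 := by simpa using hp
    have hmp := (volume_preserving_piFinSuccAbove (fun _ : Fin (m + 1) => ℝ) 0).symm
    rw [← hmp.measure_preimage hmeas.nullMeasurableSet, Measure.volume_eq_prod,
      Measure.prod_apply_symm (hmp.measurable hmeas)]
    have hlead := ih _ (Polynomial.leadingCoeff_ne_zero.2 hq)
    refine (lintegral_congr_ae ?_).trans lintegral_zero
    have hae : ∀ᵐ z : Fin m → ℝ, eval z (finSuccEquiv ℝ m p).leadingCoeff ≠ 0 := by
      rw [ae_iff]; simpa using hlead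
    filter_upwards [hae] with z hz
    have hne : Polynomial.map (eval z) (finSuccEquiv ℝ m p) ≠ 0 := by
      intro h0
      apply hz
      have := congrArg (fun q => q.coeff (finSuccEquiv ℝ m p).natDegree) h0
      simpa [Polynomial.coeff_map] using this
    refine measure_mono_null (fun y hy => ?_)
      ((Polynomial.map (eval z) (finSuccEquiv ℝ m p)).roots.toFinset.measure_zero volume)
    have hy' : eval (Fin.cons y z : Fin (m + 1) → ℝ) p = 0 := by
      simpa [MeasurableEquiv.piFinSuccAbove_symm_apply, Fin.insertNthEquiv,
        Fin.insertNth_zero] using hy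
    rw [eval_eq_eval_mv_eval'] at hy'
    simpa [hne] using hy'

lemma volume_polyFun_eq_zero {p : MvPolynomial (Fin (n + 1)) ℝ} (hp : p ≠ 0) :
    volume {x : Space n | polyFun p x = 0} = 0 := by
  have h := volume_eval_eq_zero (n + 1) p hp
  have hmp := EuclideanSpace.volume_preserving_symm_measurableEquiv_toLp (Fin (n + 1))
  have hmeas : MeasurableSet {x : Fin (n + 1) → ℝ | eval x p = 0} :=
    (isClosed_singleton.preimage (MvPolynomial.continuous_eval p)).measurableSet
  rw [← hmp.measure_preimage hmeas.nullMeasurableSet] at h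
  exact h

end HarmonicBlowup

/-! ### The measure theoretic normal and the density of `ω_p` -/

namespace HarmonicBlowup

variable {n : ℕ}

lemma volume_ball_scaled (x : Space n) (Q : Space n → Prop) {r : ℝ} (hr : 0 < r) :
    (volume {y ∈ Metric.ball x r | Q y}).toReal / r ^ (n + 1) =
      (volume {w ∈ Metric.ball x 1 | Q (AffineMap.homothety x r w)}).toReal := by
  have h : {y ∈ Metric.ball x r | Q y} =
      AffineMap.homothety x r '' {w ∈ Metric.ball x 1 | Q (AffineMap.homothety x r w)} := by
    ext y
    constructor
    · rintro ⟨hy, hQ⟩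
      have hy2 : AffineMap.homothety x r (AffineMap.homothety x r⁻¹ y) = y := by
        rw [← AffineMap.homothety_mul_apply, mul_inv_cancel₀ hr.ne', AffineMap.homothety_one]; rfl
      refine ⟨AffineMap.homothety x r⁻¹ y, ⟨?_, by rwa [hy2]⟩, hy2⟩
      rw [Metric.mem_ball, dist_homothety_center, Real.norm_eq_abs, abs_of_pos (inv_pos.2 hr),
        dist_comm, inv_mul_lt_iff₀ hr, mul_one]
      exact hy
    · rintro ⟨w, ⟨hw, hQ⟩, rfl⟩
      refine ⟨?_, hQ⟩
      rw [Metric.mem_ball] at hw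
      rw [Metric.mem_ball, dist_homothety_center, Real.norm_eq_abs, abs_of_pos hr, dist_comm]
      nlinarith
  have hp : (0 : ℝ) < r ^ (n + 1) := by positivity
  rw [h, Measure.addHaar_image_homothety, ENNReal.toReal_mul, finrank_euclideanSpace_fin,
    abs_of_pos hp, ENNReal.toReal_ofReal hp.le]
  field_simp

/-- After rescaling to the unit ball this is dominated convergence: the rescaled sets leave every
point as `r → 0`. -/
lemma tendsto_volume_ball_of_eventually_not (x : Space n) (Q : Space n → Prop)
    (hQm : MeasurableSet {y | Q y})
    (hQ : ∀ w, ∀ᶠ r in 𝓝[>] (0 : ℝ), ¬ Q (AffineMap.homothety x r w)) :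
    Tendsto (fun r : ℝ => (volume {y ∈ Metric.ball x r | Q y}).toReal / r ^ (n + 1))
      (𝓝[>] 0) (𝓝 0) := by
  have h : Tendsto (fun r : ℝ =>
      volume {w ∈ Metric.ball x 1 | Q (AffineMap.homothety x r w)}) (𝓝[>] 0)
      (𝓝 (volume (∅ : Set (Space n)))) := by
    refine tendsto_measure_of_ae_tendsto_indicator (B := Metric.ball x 1) _ MeasurableSet.empty
      (fun r => ?_) measurableSet_ball measure_ball_lt_top.ne
      (Eventually.of_forall fun r w hw => hw.1) (Eventually.of_forall fun w => ?_)
    · exact measurableSet_ball.inter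
        ((AffineMap.continuous_of_finiteDimensional (AffineMap.homothety x r)).measurable hQm)
    · filter_upwards [hQ w] with r hr
      simp only [Set.mem_empty_iff_false, iff_false]
      exact fun h => hr h.2
  rw [measure_empty] at h
  have h2 := (ENNReal.tendsto_toReal ENNReal.zero_ne_top).comp h
  refine h2.congr' ?_
  filter_upwards [self_mem_nhdsWithin] with r hr
  exact (volume_ball_scaled x Q hr).symm

/-- Two distinct normals `ν`, `ν'` bound an open wedge on the positive side of `ν` and the negative
side of `ν'`. Each of its points, rescaled, violates one of the two density conditions according to
whether it lies in `S`, so the wedge would have volume zero. -/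
lemma IsOuterNormal.unique {S : Set (Space n)} {x ν ν' : Space n} (h : IsOuterNormal S x ν)
    (h' : IsOuterNormal S x ν') : ν = ν' := by
  by_contra hne
  have hlim := h.2.1.add h'.2.2
  rw [add_zero] at hlim
  have hle : (volume {w ∈ Metric.ball x 1 | 0 < inner ℝ (w - x) ν ∧ inner ℝ (w - x) ν' < 0}).toReal
      ≤ 0 := by
    refine ge_of_tendsto hlim ?_
    filter_upwards [self_mem_nhdsWithin] with r hr
    have hr : 0 < r := hr
    rw [volume_ball_scaled x _ hr, volume_ball_scaled x _ hr, ← ENNReal.toReal_add]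
    · refine ENNReal.toReal_mono ?_ ((measure_mono ?_).trans (measure_union_le _ _))
      · exact (ENNReal.add_lt_top.2 ⟨(measure_mono fun w hw => hw.1).trans_lt measure_ball_lt_top,
          (measure_mono fun w hw => hw.1).trans_lt measure_ball_lt_top⟩).ne
      · rintro w ⟨hw, h1, h2⟩
        have he : AffineMap.homothety x r w - x = r • (w - x) := by
          simp [AffineMap.homothety_apply]
        by_cases hS : AffineMap.homothety x r w ∈ S
        · refine Or.inl ⟨hw, hS, ?_⟩
          rw [he, real_inner_smul_left]; positivity
        · refine Or.inr ⟨hw, hS, ?_⟩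
          rw [he, real_inner_smul_left]; exact mul_neg_of_pos_of_neg hr h2
    all_goals exact ((measure_mono fun w hw => hw.1).trans_lt measure_ball_lt_top).ne
  have hopen : IsOpen {w ∈ Metric.ball x 1 | 0 < inner ℝ (w - x) ν ∧ inner ℝ (w - x) ν' < 0} := by
    simp only [Set.ofPred_and]
    refine Metric.isOpen_ball.inter ((isOpen_lt ?_ ?_).inter (isOpen_lt ?_ ?_)) <;> fun_prop
  have hlt : inner ℝ ν ν' < 1 :=
    (inner_lt_one_iff_real_of_norm_eq_one h.1 h'.1).2 hne
  have hd : 0 < ‖ν - ν'‖ := norm_pos_iff.2 (sub_ne_zero.2 hne)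
  -- The direction `ν - ν'` has inner product `1 - ⟪ν, ν'⟫ > 0` with `ν` and the opposite value with
  -- `ν'`; the factor gives it length one half.
  have hmem : x + (2 * ‖ν - ν'‖)⁻¹ • (ν - ν') ∈
      {w ∈ Metric.ball x 1 | 0 < inner ℝ (w - x) ν ∧ inner ℝ (w - x) ν' < 0} := by
    refine ⟨?_, ?_, ?_⟩
    · rw [Metric.mem_ball, dist_eq_norm, add_sub_cancel_left, norm_smul, norm_inv, norm_mul,
        norm_norm]
      norm_num
      field_simp
      norm_num
    · rw [add_sub_cancel_left, real_inner_smul_left, inner_sub_left, real_inner_self_eq_norm_sq,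
        h.1, real_inner_comm]
      exact mul_pos (by positivity) (by linarith)
    · rw [add_sub_cancel_left, real_inner_smul_left, inner_sub_left, real_inner_self_eq_norm_sq,
        h'.1]
      exact mul_neg_of_pos_of_neg (by positivity) (by linarith)
  have hpos := hopen.measure_pos volume ⟨_, hmem⟩
  have := ENNReal.toReal_pos hpos.ne'
    ((measure_mono fun w hw => hw.1).trans_lt (measure_ball_lt_top (x := x) (r := 1))).ne
  linarith

lemma tendsto_polyFun_homothety (p : MvPolynomial (Fin (n + 1)) ℝ) {x : Space n}
    (hx : polyFun p x = 0) (w : Space n) :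
    Tendsto (fun r : ℝ => r⁻¹ * polyFun p (AffineMap.homothety x r w)) (𝓝[>] 0)
      (𝓝 (inner ℝ (gradVec p x) (w - x))) := by
  have h := (hasFDerivAt_polyFun p x).hasLineDerivAt (w - x)
  have h1 := (hasDerivAt_iff_tendsto_slope_zero.1 h).mono_left
    (nhdsWithin_mono (0 : ℝ) (fun r (hr : 0 < r) => hr.ne'))
  simp only [innerSL_apply_apply] at h1
  refine h1.congr fun r => ?_
  simp [hx, AffineMap.homothety_apply, add_comm]

/-- Along each ray from `x` the sign of `p` is eventually that of its directional derivative. Where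
this derivative vanishes, the strict inequalities of the half spaces fail already. -/
lemma isOuterNormal_polyFun (p : MvPolynomial (Fin (n + 1)) ℝ) {x : Space n}
    (hx : polyFun p x = 0) (hg : gradVec p x ≠ 0) :
    IsOuterNormal {y | 0 < polyFun p y} x (-(‖gradVec p x‖⁻¹ • gradVec p x)) := by
  have hpos : 0 < ‖gradVec p x‖ := norm_pos_iff.2 hg
  have he (r : ℝ) (w : Space n) : AffineMap.homothety x r w - x = r • (w - x) := by
    simp [AffineMap.homothety_apply]
  have hin (r : ℝ) (w : Space n) :
      inner ℝ (AffineMap.homothety x r w - x) (-(‖gradVec p x‖⁻¹ • gradVec p x)) =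
        -(r * ‖gradVec p x‖⁻¹ * inner ℝ (gradVec p x) (w - x)) := by
    rw [he, inner_neg_right, real_inner_smul_left, real_inner_smul_right, real_inner_comm]
    ring
  refine ⟨?_, ?_, ?_⟩
  · rw [norm_neg, norm_smul, norm_inv, norm_norm, inv_mul_cancel₀ hpos.ne']
  · refine tendsto_volume_ball_of_eventually_not x _ ?_ fun w => ?_
    · simp only [Set.ofPred_and, Set.mem_ofPred_eq]
      refine MeasurableSet.inter (measurableSet_lt ?_ ?_) (measurableSet_lt ?_ ?_) <;>
        exact Continuous.measurable (by fun_prop)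
    · rcases le_or_gt 0 (inner ℝ (gradVec p x) (w - x)) with hw | hw
      · filter_upwards [self_mem_nhdsWithin] with r hr
        rintro ⟨-, h2⟩
        rw [hin] at h2
        have hr : 0 < r := hr
        have : 0 ≤ r * ‖gradVec p x‖⁻¹ * inner ℝ (gradVec p x) (w - x) := by positivity
        linarith
      · filter_upwards [self_mem_nhdsWithin,
          (tendsto_polyFun_homothety p hx w).eventually_lt_const hw] with r hr h1
        rintro ⟨h2, -⟩
        have hr : 0 < r := hr
        have h2 : 0 < polyFun p (AffineMap.homothety x r w) := h2
        have : 0 < r⁻¹ * polyFun p (AffineMap.homothety x r w) := by positivity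
        linarith
  · refine tendsto_volume_ball_of_eventually_not x _ ?_ fun w => ?_
    · simp only [Set.ofPred_and, Set.mem_ofPred_eq, not_lt]
      refine MeasurableSet.inter (measurableSet_le ?_ ?_)
        (measurableSet_lt ?_ ?_) <;> exact Continuous.measurable (by fun_prop)
    · rcases le_or_gt (inner ℝ (gradVec p x) (w - x)) 0 with hw | hw
      · filter_upwards [self_mem_nhdsWithin] with r hr
        rintro ⟨-, h2⟩
        rw [hin] at h2
        have hr : 0 < r := hr
        have : r * ‖gradVec p x‖⁻¹ * inner ℝ (gradVec p x) (w - x) ≤ 0 :=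
          mul_nonpos_of_nonneg_of_nonpos (by positivity) hw
        linarith
      · filter_upwards [self_mem_nhdsWithin,
          (tendsto_polyFun_homothety p hx w).eventually_const_lt hw] with r hr h1
        rintro ⟨h2, -⟩
        have hr : 0 < r := hr
        have h2 : ¬ 0 < polyFun p (AffineMap.homothety x r w) := h2
        exact h2 ((mul_pos_iff_of_pos_left (inv_pos.2 hr)).1 h1)

/-- At critical points both sides vanish whatever value `outerNormal` takes, so no description of
the singular set is needed. -/
lemma neg_inner_outerNormal_polyFun (p : MvPolynomial (Fin (n + 1)) ℝ) {x : Space n}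
    (hx : polyFun p x = 0) :
    -inner ℝ (outerNormal {y | 0 < polyFun p y} x) (gradient (polyFun p) x) = ‖gradVec p x‖ := by
  rw [gradient_polyFun]
  by_cases hg : gradVec p x = 0
  · simp [hg]
  · have hex : ∃ ν, IsOuterNormal {y | 0 < polyFun p y} x ν := ⟨_, isOuterNormal_polyFun p hx hg⟩
    rw [outerNormal, dif_pos hex, hex.choose_spec.unique (isOuterNormal_polyFun p hx hg),
      inner_neg_left, neg_neg, real_inner_smul_left, real_inner_self_eq_norm_sq]
    have : ‖gradVec p x‖ ≠ 0 := norm_ne_zero_iff.2 hg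
    field_simp

lemma measurableSet_polyFun_eq_zero (p : MvPolynomial (Fin (n + 1)) ℝ) :
    MeasurableSet {x : Space n | polyFun p x = 0} :=
  (isClosed_singleton.preimage (continuous_polyFun p)).measurableSet

lemma lintegral_omega (p : MvPolynomial (Fin (n + 1)) ℝ) {F : Space n → ENNReal}
    (hF : Measurable F) :
    ∫⁻ x, F x ∂(omega (polyFun p)) =
      ∫⁻ x in {x | polyFun p x = 0}, ENNReal.ofReal ‖gradVec p x‖ * F x ∂μHE[n] := by
  have h : omega (polyFun p) = ((μHE[n] : Measure (Space n)).restrict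
      {x | polyFun p x = 0}).withDensity (fun x => ENNReal.ofReal ‖gradVec p x‖) := by
    refine withDensity_congr_ae ?_
    filter_upwards [ae_restrict_mem (measurableSet_polyFun_eq_zero p)] with x hx
    rw [neg_inner_outerNormal_polyFun p hx]
  rw [h, lintegral_withDensity_eq_lintegral_mul _
    (Continuous.measurable (by fun_prop)).ennreal_ofReal hF]
  rfl

end HarmonicBlowup

/-! ### The flux functional and integration along lines -/

namespace HarmonicBlowup

variable {n : ℕ}

lemma contDiff_of_contDiffAt_tsupport {E F : Type*} [NormedAddCommGroup E] [NormedSpace ℝ E]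
    [NormedAddCommGroup F] [NormedSpace ℝ F] {f : E → F} {m : WithTop ℕ∞}
    (h : ∀ x ∈ tsupport f, ContDiffAt ℝ m f x) : ContDiff ℝ m f := by
  rw [contDiff_iff_contDiffAt]
  intro x
  by_cases hx : x ∈ tsupport f
  · exact h x hx
  · exact contDiffAt_const.congr_of_eventuallyEq (notMem_tsupport_iff_eventuallyEq.1 hx)

@[fun_prop] lemma measurable_real_sign : Measurable Real.sign := by
  have : Real.sign = fun r : ℝ => if r < 0 then (-1 : ℝ) else if 0 < r then 1 else 0 := by
    ext r; rfl
  rw [this]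
  exact Measurable.ite measurableSet_Iio measurable_const
    (Measurable.ite measurableSet_Ioi measurable_const measurable_const)

lemma abs_real_sign_le (r : ℝ) : |Real.sign r| ≤ 1 := by
  rcases Real.sign_apply_eq r with h | h | h <;> rw [h] <;> norm_num

/-- The functional `φ ↦ -½ ∫ sign(p) ⟪∇p, ∇φ⟫`, that is, half of the distributional Laplacian
of `|p|` when `p` is a polynomial. -/
noncomputable def halfLapAbs (p : MvPolynomial (Fin (n + 1)) ℝ) (φ : Space n → ℝ) : ℝ :=
  -(1 / 2) * ∫ x, Real.sign (polyFun p x) * fderiv ℝ φ x (gradVec p x)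

lemma continuous_fderiv_apply_vec {φ : Space n → ℝ} (hφ : ContDiff ℝ 1 φ) {V : Space n → Space n}
    (hV : Continuous V) : Continuous fun x => fderiv ℝ φ x (V x) :=
  (hφ.continuous_fderiv one_ne_zero).clm_apply hV

lemma hasCompactSupport_fderiv_apply_vec {φ : Space n → ℝ} (hc : HasCompactSupport φ)
    (V : Space n → Space n) : HasCompactSupport fun x => fderiv ℝ φ x (V x) := by
  refine (hc.fderiv ℝ).mono fun x hx h0 => hx ?_
  simp only [h0, zero_apply]

lemma integrable_sign_mul (p : MvPolynomial (Fin (n + 1)) ℝ) {F : Space n → ℝ}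
    (hF : Integrable F) : Integrable fun x => Real.sign (polyFun p x) * F x := by
  refine hF.bdd_mul (c := 1) ?_ (Eventually.of_forall fun x => abs_real_sign_le _)
  exact (measurable_real_sign.comp (continuous_polyFun p).measurable).aestronglyMeasurable

lemma integrable_fderiv_apply_vec {φ : Space n → ℝ} (hφ : ContDiff ℝ 1 φ)
    (hc : HasCompactSupport φ) {V : Space n → Space n}
    (hV : Continuous V) : Integrable fun x => fderiv ℝ φ x (V x) :=
  (continuous_fderiv_apply_vec hφ hV).integrable_of_hasCompactSupport
    (hasCompactSupport_fderiv_apply_vec hc V)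

/-- Makes `arctan (k * p)` a smooth, uniformly bounded substitute for `π/2 * sign p`. -/
lemma tendsto_arctan_mul (r : ℝ) : Tendsto (fun k : ℕ => Real.arctan (k * r)) atTop
    (𝓝 (Real.pi / 2 * Real.sign r)) := by
  rcases lt_trichotomy r 0 with h | h | h
  · rw [Real.sign_of_neg h, mul_neg_one]
    exact (tendsto_nhds_of_tendsto_nhdsWithin Real.tendsto_arctan_atBot).comp
      ((tendsto_natCast_atTop_atTop (R := ℝ)).atTop_mul_const_of_neg h)
  · subst h; simp
  · rw [Real.sign_of_pos h, mul_one]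
    exact (tendsto_nhds_of_tendsto_nhdsWithin Real.tendsto_arctan_atTop).comp
      ((tendsto_natCast_atTop_atTop (R := ℝ)).atTop_mul_const h)

/-- A `C¹` vector field with compact support that is tangent to the level sets of `p` has zero
flux through `{p = 0}`. -/
lemma integral_sign_mul_div_eq_zero (p : MvPolynomial (Fin (n + 1)) ℝ) {ι : Type*} [Fintype ι]
    (ψ : ι → Space n → ℝ) (v : ι → Space n) (hψ : ∀ i, ContDiff ℝ 1 (ψ i))
    (hc : ∀ i, HasCompactSupport (ψ i))
    (htan : ∀ x, ∑ i, ψ i x * inner ℝ (gradVec p x) (v i) = 0) :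
    ∫ x, Real.sign (polyFun p x) * ∑ i, fderiv ℝ (ψ i) x (v i) = 0 := by
  have hint (i : ι) : Integrable fun x => fderiv ℝ (ψ i) x (v i) :=
    integrable_fderiv_apply_vec (hψ i) (hc i) continuous_const
  have hzero (k : ℕ) :
      ∫ x, Real.arctan (k * polyFun p x) * ∑ i, fderiv ℝ (ψ i) x (v i) = 0 := by
    have hderiv (x : Space n) : HasFDerivAt (fun x => Real.arctan (k * polyFun p x))
        ((1 / (1 + (k * polyFun p x) ^ 2)) • ((k : ℝ) • innerSL ℝ (gradVec p x))) x :=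
      ((hasFDerivAt_polyFun p x).const_mul (k : ℝ)).arctan
    have hcd : ContDiff ℝ 1 (fun x : Space n => Real.arctan (k * polyFun p x)) :=
      (contDiff_const.mul (contDiff_polyFun p)).arctan
    -- Integration by parts moves the derivative onto `arctan (k * p)`, whose gradient is a multiple
    -- of `∇p`; summed over `i`, the result vanishes by `htan`.
    have hpart (i : ι) : ∫ x, Real.arctan (k * polyFun p x) * fderiv ℝ (ψ i) x (v i) =
        -∫ x, (1 / (1 + (k * polyFun p x) ^ 2)) * k *
          (ψ i x * inner ℝ (gradVec p x) (v i)) := by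
      rw [integral_mul_fderiv_eq_neg_fderiv_mul_of_integrable]
      · congr 2 with x
        rw [(hderiv x).fderiv]
        simp
        ring
      · exact ((continuous_fderiv_apply_vec hcd continuous_const).mul
          (hψ i).continuous).integrable_of_hasCompactSupport (hc i).mul_left
      · exact (hcd.continuous.mul (continuous_fderiv_apply_vec (hψ i)
          continuous_const)).integrable_of_hasCompactSupport
          (hasCompactSupport_fderiv_apply_vec (hc i) _).mul_left
      · exact (hcd.continuous.mul (hψ i).continuous).integrable_of_hasCompactSupport
          (hc i).mul_left
      · exact fun x _ => (hderiv x).differentiableAt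
      · exact fun x _ => (hψ i).differentiable one_ne_zero x
    have hcont : Continuous fun x => (1 / (1 + (k * polyFun p x) ^ 2)) * k := by
      refine Continuous.mul (Continuous.div continuous_const (by fun_prop) fun x => ?_)
        continuous_const
      positivity
    simp_rw [Finset.mul_sum]
    rw [integral_finsetSum]
    · simp_rw [hpart]
      rw [Finset.sum_neg_distrib, ← integral_finsetSum]
      · simp_rw [← Finset.mul_sum, htan]
        simp
      · intro i _
        exact (hcont.mul ((hψ i).continuous.mul (by fun_prop))).integrable_of_hasCompactSupport
          (hc i).mul_right.mul_left
    · intro i _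
      exact (hcd.continuous.mul (continuous_fderiv_apply_vec (hψ i)
          continuous_const)).integrable_of_hasCompactSupport
          (hasCompactSupport_fderiv_apply_vec (hc i) _).mul_left
  have hlim : Tendsto
      (fun k : ℕ => ∫ x, Real.arctan (k * polyFun p x) * ∑ i, fderiv ℝ (ψ i) x (v i)) atTop
      (𝓝 (∫ x, Real.pi / 2 * Real.sign (polyFun p x) * ∑ i, fderiv ℝ (ψ i) x (v i))) := by
    refine tendsto_integral_of_dominated_convergence
      (fun x => Real.pi / 2 * ‖∑ i, fderiv ℝ (ψ i) x (v i)‖) (fun k => ?_) ?_ (fun k => ?_) ?_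
    · refine Continuous.aestronglyMeasurable (Continuous.mul (by fun_prop)
        (continuous_finsetSum _ fun i _ => continuous_fderiv_apply_vec (hψ i) continuous_const))
    · exact (integrable_finsetSum _ fun i _ => hint i).norm.const_mul _
    · refine Eventually.of_forall fun x => ?_
      rw [norm_mul]
      gcongr
      rw [Real.norm_eq_abs, abs_le]
      exact ⟨(Real.neg_pi_div_two_lt_arctan _).le, (Real.arctan_lt_pi_div_two _).le⟩
    · exact Eventually.of_forall fun x => (tendsto_arctan_mul _).mul_const _
  simp_rw [hzero, mul_assoc] at hlim
  rw [integral_const_mul] at hlim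
  have := tendsto_nhds_unique hlim tendsto_const_nhds
  exact (mul_eq_zero.1 this).resolve_left (by positivity)

/-- If `φ ∇p` and `ψ e` have the same component normal to the level sets of the harmonic polynomial
`p`, then they have the same flux through `{p = 0}`. -/
lemma IsHarmonicPoly.halfLapAbs_eq {p : MvPolynomial (Fin (n + 1)) ℝ} (hp : IsHarmonicPoly p)
    {φ ψ : Space n → ℝ} (hφ : ContDiff ℝ 1 φ) (hφc : HasCompactSupport φ)
    (hψ : ContDiff ℝ 1 ψ) (hψc : HasCompactSupport ψ) (e : Space n)
    (h : ∀ x, φ x * ‖gradVec p x‖ ^ 2 = ψ x * inner ℝ (gradVec p x) e) :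
    halfLapAbs p φ = -(1 / 2) * ∫ x, Real.sign (polyFun p x) * fderiv ℝ ψ x e := by
  -- The tangent field is `φ ∇p - ψ e`: the `Fin (n + 1)` summands carry `φ ∇p` in coordinates, the
  -- `Unit` summand carries `-ψ e`.
  have h0 := integral_sign_mul_div_eq_zero p (ι := Fin (n + 1) ⊕ Unit)
    (Sum.elim (fun i x => φ x * polyFun (MvPolynomial.pderiv i p) x) (fun _ x => -ψ x))
    (Sum.elim (fun i => EuclideanSpace.single i 1) (fun _ => e)) ?_ ?_ ?_
  · have hdiv (x : Space n) : ∑ i, fderiv ℝ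
        (fun x => φ x * polyFun (MvPolynomial.pderiv i p) x) x (EuclideanSpace.single i (1 : ℝ)) =
        fderiv ℝ φ x (gradVec p x) := by
      have h1 (i : Fin (n + 1)) : fderiv ℝ
          (fun x => φ x * polyFun (MvPolynomial.pderiv i p) x) x (EuclideanSpace.single i (1 : ℝ)) =
          φ x * polyFun (MvPolynomial.pderiv i (MvPolynomial.pderiv i p)) x +
          polyFun (MvPolynomial.pderiv i p) x * fderiv ℝ φ x (EuclideanSpace.single i 1) := by
        rw [fderiv_fun_mul (hφ.differentiable one_ne_zero x)
          (hasFDerivAt_polyFun _ x).differentiableAt]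
        simp [fderiv_polyFun, EuclideanSpace.inner_single_right]
      simp_rw [h1]
      rw [Finset.sum_add_distrib, ← Finset.mul_sum, hp.sum_pderiv_pderiv, mul_zero, zero_add]
      have h2 : gradVec p x = ∑ i, polyFun (MvPolynomial.pderiv i p) x •
          EuclideanSpace.single i (1 : ℝ) := by
        ext j
        simp [Finset.sum_apply, Pi.single_apply]
      conv_rhs => rw [h2]
      simp
    have h3 (x : Space n) : Real.sign (polyFun p x) * ∑ i : Fin (n + 1) ⊕ Unit, fderiv ℝ
        (Sum.elim (fun i x => φ x * polyFun (MvPolynomial.pderiv i p) x) (fun _ x => -ψ x) i) x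
        (Sum.elim (fun i => EuclideanSpace.single i 1) (fun _ => e) i) =
        Real.sign (polyFun p x) * fderiv ℝ φ x (gradVec p x) -
        Real.sign (polyFun p x) * fderiv ℝ ψ x e := by
      rw [Fintype.sum_sum_type]
      simp only [Sum.elim_inl, Sum.elim_inr, hdiv]
      simp [fderiv_fun_neg]
      ring
    simp_rw [h3] at h0
    rw [integral_sub (integrable_sign_mul p (integrable_fderiv_apply_vec hφ hφc (by fun_prop)))
      (integrable_sign_mul p (integrable_fderiv_apply_vec hψ hψc continuous_const))] at h0
    rw [halfLapAbs]
    linarith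
  · rintro (i | i)
    · exact hφ.mul (contDiff_polyFun _)
    · exact hψ.neg
  · rintro (i | i)
    · exact hφc.mul_right
    · exact hψc.neg
  · intro x
    rw [Fintype.sum_sum_type]
    simp only [Sum.elim_inl, Sum.elim_inr]
    have h1 : ∑ i, φ x * polyFun (MvPolynomial.pderiv i p) x *
        inner ℝ (gradVec p x) (EuclideanSpace.single i (1 : ℝ)) = φ x * ‖gradVec p x‖ ^ 2 := by
      rw [EuclideanSpace.norm_sq_eq, Finset.mul_sum]
      refine Finset.sum_congr rfl fun i _ => ?_
      simp [EuclideanSpace.inner_single_right]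
      ring
    rw [h1, h]
    simp

/-- Orthogonal coordinates adapted to a unit vector `e`. -/
lemma exists_orthogonal_coordinates (e : Space n) (he : ‖e‖ = 1) :
    ∃ (J : EuclideanSpace ℝ (Fin n) →L[ℝ] Space n) (P : Space n →L[ℝ] EuclideanSpace ℝ (Fin n)),
      MeasurePreserving (fun z : EuclideanSpace ℝ (Fin n) × ℝ => J z.1 + z.2 • e) ∧
      (∀ y (s : ℝ), P (J y + s • e) = y) ∧ (∀ x, J (P x) + inner ℝ e x • e = x) ∧
      (∀ x, ‖P x‖ ≤ ‖x‖) ∧ (∀ y, ‖J y‖ = ‖y‖) := by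
  have horth : Orthonormal ℝ (Set.domRestrict {(0 : Fin (n + 1))} fun _ : Fin (n + 1) => e) := by
    refine ⟨fun i => he, fun i j hij => absurd (Subsingleton.elim i j) hij⟩
  obtain ⟨b, hb⟩ := horth.exists_orthonormalBasis_extension_of_card_eq (by simp)
  have hb0 : b 0 = e := hb 0 (by simp)
  have hrepr0 : b.repr e = EuclideanSpace.single 0 1 := by rw [← hb0, b.repr_self]
  let T : EuclideanSpace ℝ (Fin n) →L[ℝ] EuclideanSpace ℝ (Fin (n + 1)) :=
    LinearMap.toContinuousLinearMap
      { toFun := fun y => WithLp.toLp 2 (Fin.cons 0 y : Fin (n + 1) → ℝ)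
        map_add' := fun y z => by
          ext i; refine Fin.cases ?_ (fun j => ?_) i <;> simp
        map_smul' := fun c y => by
          ext i; refine Fin.cases ?_ (fun j => ?_) i <;> simp }
  let R : EuclideanSpace ℝ (Fin (n + 1)) →L[ℝ] EuclideanSpace ℝ (Fin n) :=
    LinearMap.toContinuousLinearMap
      { toFun := fun x => WithLp.toLp 2 (fun i => x i.succ)
        map_add' := fun y z => by ext i; simp
        map_smul' := fun c y => by ext i; simp }
  have hT0 (y) : T y 0 = 0 := rfl
  have hTs (y) (i : Fin n) : T y i.succ = y i := rfl
  have hR (x) (i : Fin n) : R x i = x i.succ := rfl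
  have hQ (y : EuclideanSpace ℝ (Fin n)) (s : ℝ) : b.repr.symm (T y) + s • e =
      b.repr.symm (WithLp.toLp 2 (Fin.cons s y : Fin (n + 1) → ℝ)) := by
    apply b.repr.injective
    rw [map_add, map_smul, hrepr0, LinearIsometryEquiv.apply_symm_apply,
      LinearIsometryEquiv.apply_symm_apply]
    ext i
    refine Fin.cases ?_ (fun j => ?_) i
    · simp [hT0]
    · simp [hTs]
  refine ⟨b.repr.symm.toContinuousLinearEquiv.toContinuousLinearMap.comp T,
    R.comp b.repr.toContinuousLinearEquiv.toContinuousLinearMap, ?_, ?_, ?_, ?_, ?_⟩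
  · have h1 : MeasurePreserving (Prod.swap : EuclideanSpace ℝ (Fin n) × ℝ → _) :=
      Measure.measurePreserving_swap
    have h2 : MeasurePreserving (Prod.map id (WithLp.ofLp (p := 2)) :
        ℝ × EuclideanSpace ℝ (Fin n) → ℝ × (Fin n → ℝ)) :=
      (MeasurePreserving.id volume).prod (PiLp.volume_preserving_ofLp (Fin n))
    have h3 := (volume_preserving_piFinSuccAbove (fun _ : Fin (n + 1) => ℝ) 0).symm
    have h4 := PiLp.volume_preserving_toLp (Fin (n + 1))
    have h5 := b.measurePreserving_repr_symm
    have h6 := h5.comp (h4.comp (h3.comp (h2.comp h1)))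
    convert! h6 using 1
    ext1 ⟨y, s⟩
    refine (hQ y s).trans ?_
    simp [MeasurableEquiv.piFinSuccAbove_symm_apply, Fin.insertNthEquiv]
  · intro y s
    change R (b.repr (b.repr.symm (T y) + s • e)) = y
    rw [hQ, LinearIsometryEquiv.apply_symm_apply]
    ext i
    simp [hR]
  · intro x
    change b.repr.symm (T (R (b.repr x))) + inner ℝ e x • e = x
    rw [hQ]
    apply b.repr.injective
    rw [LinearIsometryEquiv.apply_symm_apply]
    ext i
    refine Fin.cases ?_ (fun j => ?_) i
    · simp [b.repr_apply_apply, hb0]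
    · simp [hR]
  · intro x
    change ‖R (b.repr x)‖ ≤ ‖x‖
    rw [← b.repr.norm_map x]
    refine le_of_sq_le_sq ?_ (norm_nonneg _)
    rw [EuclideanSpace.norm_sq_eq, EuclideanSpace.norm_sq_eq, Fin.sum_univ_succ]
    simp only [hR]
    linarith [sq_nonneg ‖b.repr x 0‖]
  · intro y
    change ‖b.repr.symm (T y)‖ = ‖y‖
    rw [LinearIsometryEquiv.norm_map, EuclideanSpace.norm_eq, EuclideanSpace.norm_eq,
      Fin.sum_univ_succ]
    simp [hT0, hTs]

/-- The fundamental theorem of calculus on both sides of `s₀`: the jump of the sign contributes the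
factor two, which the `1/2` in `halfLapAbs` cancels. -/
lemma integral_sign_sub_mul_deriv {ψ : ℝ → ℝ} (hψ : ContDiff ℝ 1 ψ) (hc : HasCompactSupport ψ)
    (s₀ : ℝ) : ∫ s, Real.sign (s - s₀) * deriv ψ s = -2 * ψ s₀ := by
  have hint : Integrable fun s => Real.sign (s - s₀) * deriv ψ s := by
    refine ((hψ.continuous_deriv le_rfl).integrable_of_hasCompactSupport hc.deriv).bdd_mul (c := 1)
      ?_ (Eventually.of_forall fun x => abs_real_sign_le _)
    exact Measurable.aestronglyMeasurable (by fun_prop)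
  rw [← intervalIntegral.integral_Iic_add_Ioi (b := s₀) hint.integrableOn hint.integrableOn]
  have h1 : ∫ s in Set.Iic s₀, Real.sign (s - s₀) * deriv ψ s = -ψ s₀ := by
    rw [← hc.integral_Iic_deriv_eq hψ s₀, integral_Iic_eq_integral_Iio, integral_Iic_eq_integral_Iio,
      ← integral_neg]
    refine setIntegral_congr_fun measurableSet_Iio fun s hs => ?_
    simp only [Set.mem_Iio] at hs
    rw [Real.sign_of_neg (by linarith)]; ring
  have h2 : ∫ s in Set.Ioi s₀, Real.sign (s - s₀) * deriv ψ s = -ψ s₀ := by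
    rw [← hc.integral_Ioi_deriv_eq hψ s₀]
    refine setIntegral_congr_fun measurableSet_Ioi fun s hs => ?_
    simp only [Set.mem_Ioi] at hs
    rw [Real.sign_of_pos (by linarith)]; ring
  rw [h1, h2]; ring

/-- Only the values of `u` on the support of `ψ` matter, and there a strictly increasing `u` has the
sign of `s - s₀`. -/
lemma integral_sign_mul_deriv_of_zero {u ψ : ℝ → ℝ} {I : Set ℝ} (hu : StrictMonoOn u I)
    (hψ : ContDiff ℝ 1 ψ) (hc : HasCompactSupport ψ) (hI : tsupport ψ ⊆ I) {s₀ : ℝ} (hs : s₀ ∈ I)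
    (h0 : u s₀ = 0) : ∫ s, Real.sign (u s) * deriv ψ s = -2 * ψ s₀ := by
  rw [← integral_sign_sub_mul_deriv hψ hc s₀]
  refine integral_congr_ae (Eventually.of_forall fun s => ?_)
  simp only
  by_cases hsI : s ∈ I
  · rcases lt_trichotomy s s₀ with h | h | h
    · rw [Real.sign_of_neg (by linarith [hu hsI hs h]), Real.sign_of_neg (by linarith)]
    · rw [h, h0, sub_self]
    · rw [Real.sign_of_pos (by linarith [hu hs hsI h]), Real.sign_of_pos (by linarith)]
  · have : deriv ψ s = 0 := by
      by_contra hne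
      exact hsI (hI (support_deriv_subset hne))
    rw [this, mul_zero, mul_zero]

lemma integral_sign_mul_deriv_of_ne_zero {u ψ : ℝ → ℝ} {I : Set ℝ} (hu : ContinuousOn u I)
    (hI' : I.OrdConnected)
    (hψ : ContDiff ℝ 1 ψ) (hc : HasCompactSupport ψ) (hI : tsupport ψ ⊆ I)
    (h0 : ∀ s ∈ I, u s ≠ 0) : ∫ s, Real.sign (u s) * deriv ψ s = 0 := by
  have hsgn : ∃ c : ℝ, ∀ s ∈ I, Real.sign (u s) = c := by
    by_cases hall : ∀ s ∈ I, 0 < u s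
    · exact ⟨1, fun s hs => Real.sign_of_pos (hall s hs)⟩
    · push Not at hall
      obtain ⟨a, ha, hua⟩ := hall
      refine ⟨-1, fun s hs => Real.sign_of_neg ?_⟩
      by_contra hs0
      have := hI'.isPreconnected.intermediate_value ha hs hu
      obtain ⟨w, hw, hw0⟩ := this ⟨hua, not_lt.1 hs0⟩
      exact h0 w hw hw0
  obtain ⟨c, hcI⟩ := hsgn
  have h1 : ∫ s, Real.sign (u s) * deriv ψ s = ∫ s, c * deriv ψ s := by
    refine integral_congr_ae (Eventually.of_forall fun s => ?_)
    simp only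
    by_cases hsI : s ∈ I
    · rw [hcI s hsI]
    · have : deriv ψ s = 0 := by
        by_contra hne
        exact hsI (hI (support_deriv_subset hne))
      rw [this, mul_zero, mul_zero]
  have hint := (hψ.continuous_deriv le_rfl).integrable_of_hasCompactSupport hc.deriv (μ := volume)
  rw [h1, integral_const_mul,
    ← intervalIntegral.integral_Iic_add_Ioi (b := 0) hint.integrableOn hint.integrableOn,
    hc.integral_Iic_deriv_eq hψ, hc.integral_Ioi_deriv_eq hψ]
  ring

end HarmonicBlowup

/-! ### Surface measure on nearly flat pieces of `{p = 0}` -/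

namespace HarmonicBlowup

variable {n : ℕ}

lemma euclideanHausdorffMeasure_image_le {X Y : Type*} [MetricSpace X] [MeasurableSpace X]
    [BorelSpace X] [MetricSpace Y] [MeasurableSpace Y] [BorelSpace Y] {f : X → Y} {s : Set X}
    {K : NNReal} (hf : LipschitzOnWith K f s) (d : ℕ) :
    (μHE[d] : Measure Y) (f '' s) ≤ (K : ENNReal) ^ d * μHE[d] s := by
  simp only [Measure.euclideanHausdorffMeasure_def, Measure.smul_apply]
  have h := hf.hausdorffMeasure_image_le (d := d) (by positivity)
  rw [ENNReal.rpow_natCast] at h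
  simp only [ENNReal.smul_def, smul_eq_mul]
  rw [mul_left_comm]
  gcongr

/-- `P` does not increase Hausdorff measure, and its inverse on `P '' S` is `K`-Lipschitz. In
dimension `n` the normalized Hausdorff measure is Lebesgue measure. -/
lemma map_restrict_euclideanHausdorffMeasure {S : Set (Space n)}
    {P : Space n → EuclideanSpace ℝ (Fin n)} (hP : LipschitzWith 1 P) {K : NNReal}
    (hK : ∀ y ∈ S, ∀ z ∈ S, dist y z ≤ K * dist (P y) (P z)) :
    volume.restrict (P '' S) ≤ ((μHE[n] : Measure (Space n)).restrict S).map P ∧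
    ((μHE[n] : Measure (Space n)).restrict S).map P ≤
      (K : ENNReal) ^ n • volume.restrict (P '' S) := by
  have himage (B : Set (EuclideanSpace ℝ (Fin n))) : P '' (P ⁻¹' B ∩ S) = B ∩ P '' S := by
    rw [Set.inter_comm, Set.image_inter_preimage, Set.inter_comm]
  constructor
  · refine Measure.le_iff.2 fun B hB => ?_
    rw [Measure.map_apply hP.continuous.measurable hB, Measure.restrict_apply hB,
      Measure.restrict_apply (hP.continuous.measurable hB), ← himage,
      ← EuclideanSpace.euclideanHausdorffMeasure_eq_volume]
    have := euclideanHausdorffMeasure_image_le (hP.lipschitzOnWith (s := P ⁻¹' B ∩ S)) n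
    simpa using this
  · refine Measure.le_iff.2 fun B hB => ?_
    rw [Measure.map_apply hP.continuous.measurable hB, Measure.smul_apply,
      Measure.restrict_apply hB,
      Measure.restrict_apply (hP.continuous.measurable hB), ← himage,
      ← EuclideanSpace.euclideanHausdorffMeasure_eq_volume, smul_eq_mul]
    have hinj : Set.InjOn P S := fun y hy z hz hyz => by
      have := hK y hy z hz
      rw [hyz, dist_self, mul_zero] at this
      exact dist_le_zero.1 this
    have hinv : Set.LeftInvOn (Function.invFunOn P S) P S := hinj.leftInvOn_invFunOn
    have hlip : LipschitzOnWith K (Function.invFunOn P S) (P '' (P ⁻¹' B ∩ S)) := by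
      refine LipschitzOnWith.of_dist_le_mul ?_
      rintro _ ⟨y, ⟨-, hy⟩, rfl⟩ _ ⟨z, ⟨-, hz⟩, rfl⟩
      rw [hinv hy, hinv hz]
      exact hK y hy z hz
    have := euclideanHausdorffMeasure_image_le hlip n
    rwa [(hinv.mono Set.inter_subset_right).image_image] at this

lemma integral_eq_integral_coordinates {e : Space n}
    {J : EuclideanSpace ℝ (Fin n) →L[ℝ] Space n}
    (hQ : MeasurePreserving (fun z : EuclideanSpace ℝ (Fin n) × ℝ => J z.1 + z.2 • e))
    {f : Space n → ℝ} (hf : Integrable f) :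
    Integrable (fun y => ∫ s : ℝ, f (J y + s • e)) ∧
      ∫ x, f x = ∫ y, ∫ s : ℝ, f (J y + s • e) := by
  have hint : Integrable (fun z : EuclideanSpace ℝ (Fin n) × ℝ => f (J z.1 + z.2 • e)) :=
    hQ.integrable_comp_of_integrable hf
  rw [Measure.volume_eq_prod] at hint
  refine ⟨hint.integral_prod_left, ?_⟩
  rw [← integral_prod _ hint, ← Measure.volume_eq_prod]
  conv_lhs => rw [← hQ.map_eq]
  rw [integral_map hQ.measurable.aemeasurable]
  rw [hQ.map_eq]
  exact hf.aestronglyMeasurable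

lemma measurable_integral_sign_mul (p : MvPolynomial (Fin (n + 1)) ℝ) {f : Space n → ℝ}
    (hf : Continuous f) (J : EuclideanSpace ℝ (Fin n) →L[ℝ] Space n) (e : Space n) :
    Measurable fun y => ∫ s : ℝ, Real.sign (polyFun p (J y + s • e)) * f (J y + s • e) := by
  have h : StronglyMeasurable fun z : EuclideanSpace ℝ (Fin n) × ℝ =>
      Real.sign (polyFun p (J z.1 + z.2 • e)) * f (J z.1 + z.2 • e) := by
    refine Measurable.stronglyMeasurable (Measurable.mul (measurable_real_sign.comp ?_) ?_) <;>
      exact Continuous.measurable (by fun_prop)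
  exact h.integral_prod_right'.measurable

/-- Near a point where the gradient of `p` does not vanish, the function `p` is a small
perturbation of an affine function. -/
lemma exists_ball_gradVec_near (p : MvPolynomial (Fin (n + 1)) ℝ) {x₀ : Space n}
    (hg : gradVec p x₀ ≠ 0) {κ : ℝ} (hκ : 0 < κ) :
    ∃ ρ > 0, (∀ y ∈ Metric.ball x₀ ρ, ‖gradVec p y - gradVec p x₀‖ ≤ κ * ‖gradVec p x₀‖) ∧
      ∀ y ∈ Metric.ball x₀ ρ, ∀ z ∈ Metric.ball x₀ ρ,
        |polyFun p z - polyFun p y - inner ℝ (gradVec p x₀) (z - y)| ≤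
          κ * ‖gradVec p x₀‖ * ‖z - y‖ := by
  have hpos : 0 < κ * ‖gradVec p x₀‖ := mul_pos hκ (norm_pos_iff.2 hg)
  obtain ⟨ρ, hρ, h⟩ := Metric.continuous_iff.1 (continuous_gradVec p) x₀ _ hpos
  have h1 : ∀ y ∈ Metric.ball x₀ ρ, ‖gradVec p y - gradVec p x₀‖ ≤ κ * ‖gradVec p x₀‖ := by
    intro y hy
    rw [← dist_eq_norm]
    exact (h y hy).le
  refine ⟨ρ, hρ, h1, fun y hy z hz => ?_⟩
  have := (convex_ball x₀ ρ).norm_image_sub_le_of_norm_hasFDerivWithin_le'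
    (f := polyFun p) (f' := fun y => innerSL ℝ (gradVec p y)) (φ := innerSL ℝ (gradVec p x₀))
    (C := κ * ‖gradVec p x₀‖) (fun w _ => (hasFDerivAt_polyFun p w).hasFDerivWithinAt)
    (fun w hw => by rw [← map_sub, innerSL_apply_norm]; exact h1 w hw) hy hz
  simpa using this

/-- Local comparison of the flux functional with a surface integral over a piece of `{p = 0}`
that is nearly flat. -/
lemma halfLap_compare (p : MvPolynomial (Fin (n + 1)) ℝ) {x₀ : Space n}
    (hg : gradVec p x₀ ≠ 0) {κ : ℝ} (hκ1 : κ < 1) {ρ : ℝ}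
    (hpert : ∀ y ∈ Metric.ball x₀ ρ, ∀ z ∈ Metric.ball x₀ ρ,
        |polyFun p z - polyFun p y - inner ℝ (gradVec p x₀) (z - y)| ≤
          κ * ‖gradVec p x₀‖ * ‖z - y‖)
    {ψ : Space n → ℝ} (hψ : ContDiff ℝ 1 ψ) (hψc : HasCompactSupport ψ) (hψ0 : ∀ x, 0 ≤ ψ x)
    (hsupp : tsupport ψ ⊆ Metric.ball x₀ ρ) {A : ℝ}
    (hA : A = -(1 / 2) * ∫ x, Real.sign (polyFun p x) *
      fderiv ℝ ψ x (‖gradVec p x₀‖⁻¹ • gradVec p x₀)) :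
    0 ≤ A ∧
    ENNReal.ofReal A ≤
      ∫⁻ x in {x | polyFun p x = 0} ∩ Metric.ball x₀ ρ, ENNReal.ofReal (ψ x) ∂μHE[n] ∧
    ∫⁻ x in {x | polyFun p x = 0} ∩ Metric.ball x₀ ρ, ENNReal.ofReal (ψ x) ∂μHE[n] ≤
      ENNReal.ofReal (1 - κ)⁻¹ ^ n * ENNReal.ofReal A := by
  set N := ‖gradVec p x₀‖ with hN
  set e := N⁻¹ • gradVec p x₀ with he
  set U := Metric.ball x₀ ρ with hU
  set S := {x | polyFun p x = 0} ∩ U with hS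
  have hNpos : 0 < N := norm_pos_iff.2 hg
  have hge : gradVec p x₀ = N • e := by rw [he, smul_inv_smul₀ hNpos.ne']
  have he1 : ‖e‖ = 1 := by rw [he, norm_smul, norm_inv, ← hN, norm_norm, inv_mul_cancel₀ hNpos.ne']
  obtain ⟨J, P, hQ, hPQ, hJP, hPn, hJn⟩ := exists_orthogonal_coordinates e he1
  have hline (y : EuclideanSpace ℝ (Fin n)) : Isometry fun s : ℝ => J y + s • e := by
    refine Isometry.of_dist_eq fun s t => ?_
    rw [dist_eq_norm, add_sub_add_left_eq_sub, ← sub_smul, norm_smul, he1, mul_one, dist_eq_norm]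
  have hlcd (y : EuclideanSpace ℝ (Fin n)) : ContDiff ℝ 1 fun s : ℝ => ψ (J y + s • e) :=
    hψ.comp (by fun_prop)
  have hlc (y : EuclideanSpace ℝ (Fin n)) : HasCompactSupport fun s : ℝ => ψ (J y + s • e) :=
    hψc.comp_isClosedEmbedding (hline y).isClosedEmbedding
  have hls (y : EuclideanSpace ℝ (Fin n)) : tsupport (fun s : ℝ => ψ (J y + s • e)) ⊆
      {s | J y + s • e ∈ U} := fun s hs =>
    hsupp (tsupport_comp_subset_preimage ψ (hline y).continuous hs)
  have hderiv (y : EuclideanSpace ℝ (Fin n)) (s : ℝ) :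
      deriv (fun s : ℝ => ψ (J y + s • e)) s = fderiv ℝ ψ (J y + s • e) e := by
    have h1 : HasDerivAt (fun s : ℝ => J y + s • e) e s := by
      simpa using ((hasDerivAt_id s).smul_const e).const_add (J y)
    exact ((hψ.differentiable one_ne_zero _).hasFDerivAt.comp_hasDerivAt s h1).deriv
  have hmono (y : EuclideanSpace ℝ (Fin n)) :
      StrictMonoOn (fun s : ℝ => polyFun p (J y + s • e)) {s | J y + s • e ∈ U} := by
    intro s hs t ht hst
    have h1 := hpert _ hs _ ht
    have h2 : J y + t • e - (J y + s • e) = (t - s) • e := by rw [sub_smul]; abel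
    have hts : 0 < t - s := sub_pos.2 hst
    rw [h2, hge, real_inner_smul_left, real_inner_smul_right, real_inner_self_eq_norm_sq, he1,
      norm_smul, he1, Real.norm_eq_abs, abs_of_pos hts] at h1
    have h3 := (abs_le.1 h1).1
    have h4 : 0 < N * (t - s) * (1 - κ) := by
      have := sub_pos.2 hκ1
      positivity
    simp only
    nlinarith
  have hord (y : EuclideanSpace ℝ (Fin n)) : Set.OrdConnected {s : ℝ | J y + s • e ∈ U} := by
    have h1 : {s : ℝ | J y + s • e ∈ U} =
        AffineMap.lineMap (k := ℝ) (J y) (J y + e) ⁻¹' Metric.ball x₀ ρ := by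
      ext s
      simp [hU, AffineMap.lineMap_apply, add_comm]
    rw [h1]
    exact ((convex_ball x₀ ρ).affine_preimage _).ordConnected
  -- `F` is the flux along the line over `y`. Inside the ball `p` is strictly increasing on this
  -- line, so `F y` is the value of `ψ` at the unique zero there, or `0` if there is none.
  set F : EuclideanSpace ℝ (Fin n) → ℝ := fun y =>
    -(1 / 2) * ∫ s : ℝ, Real.sign (polyFun p (J y + s • e)) * fderiv ℝ ψ (J y + s • e) e with hF
  have hFS (z) (hz : z ∈ S) : F (P z) = ψ z := by
    have h1 := integral_sign_mul_deriv_of_zero (hmono (P z)) (hlcd (P z)) (hlc (P z)) (hls (P z))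
      (s₀ := inner ℝ e z) (by rw [Set.mem_ofPred_eq, hJP]; exact hz.2)
      (by simp only [hJP]; exact hz.1)
    simp only [hderiv, hJP] at h1
    rw [hF]
    simp only [h1]
    ring
  have hF0 (y) (hy : y ∉ P '' S) : F y = 0 := by
    have h1 := integral_sign_mul_deriv_of_ne_zero (u := fun s : ℝ => polyFun p (J y + s • e))
      (Continuous.continuousOn (by fun_prop)) (hord y) (hlcd y) (hlc y) (hls y)
      (fun s hs h0 => hy ⟨J y + s • e, ⟨h0, hs⟩, hPQ y s⟩)
    simp only [hderiv] at h1
    rw [hF]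
    simp only [h1, mul_zero]
  have hFnn (y) : 0 ≤ F y := by
    by_cases hy : y ∈ P '' S
    · obtain ⟨z, hz, rfl⟩ := hy
      rw [hFS z hz]; exact hψ0 z
    · rw [hF0 y hy]
  have hFm : Measurable F :=
    (measurable_integral_sign_mul p (continuous_fderiv_apply_vec hψ continuous_const) J e).const_mul _
  have hint := integral_eq_integral_coordinates hQ
    (integrable_sign_mul p (integrable_fderiv_apply_vec hψ hψc (V := fun _ => e) continuous_const))
  have hAF : A = ∫ y, F y := by
    rw [hA, hint.2, hF, integral_const_mul]
  have hA' : ENNReal.ofReal A = ∫⁻ y, ENNReal.ofReal (F y) := by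
    rw [hAF, ofReal_integral_eq_lintegral_ofReal (hint.1.const_mul _) (Eventually.of_forall hFnn)]
  have hSm : MeasurableSet S := (measurableSet_polyFun_eq_zero p).inter measurableSet_ball
  have hPlip : LipschitzWith 1 P := by
    refine LipschitzWith.of_dist_le_mul fun y z => ?_
    rw [dist_eq_norm, dist_eq_norm, ← map_sub, NNReal.coe_one, one_mul]
    exact hPn _
  -- Between two zeros of `p` the component along `e` is at most `κ` times the distance, which
  -- leaves at least `1 - κ` of it for `P`.
  have hanti : ∀ y ∈ S, ∀ z ∈ S, dist y z ≤ (Real.toNNReal (1 - κ)⁻¹) * dist (P y) (P z) := by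
    intro y hy z hz
    have h1 := hpert y hy.2 z hz.2
    have hκ' := sub_pos.2 hκ1
    rw [show polyFun p z = 0 from hz.1, show polyFun p y = 0 from hy.1, sub_zero, zero_sub, abs_neg,
      hge, real_inner_smul_left, abs_mul, abs_of_pos hNpos, mul_comm κ, mul_assoc] at h1
    have h2 := le_of_mul_le_mul_left h1 hNpos
    have h3 : ‖z - y‖ ≤ ‖P (z - y)‖ + |inner ℝ e (z - y)| := by
      conv_lhs => rw [← hJP (z - y)]
      refine (norm_add_le _ _).trans ?_
      rw [hJn, norm_smul, he1, mul_one, Real.norm_eq_abs]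
    rw [Real.coe_toNNReal _ (inv_nonneg.2 hκ'.le), dist_comm, dist_comm (P y), dist_eq_norm,
      dist_eq_norm, ← map_sub, inv_mul_eq_div, le_div_iff₀ hκ']
    linarith
  have hmeas := map_restrict_euclideanHausdorffMeasure hPlip hanti
  have hIS : ∫⁻ x in S, ENNReal.ofReal (ψ x) ∂μHE[n] =
      ∫⁻ y, ENNReal.ofReal (F y) ∂(((μHE[n] : Measure (Space n)).restrict S).map P) := by
    rw [lintegral_map hFm.ennreal_ofReal hPlip.continuous.measurable]
    refine setLIntegral_congr_fun hSm fun z hz => ?_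
    simp only [hFS z hz]
  have hFr : ∫⁻ y in P '' S, ENNReal.ofReal (F y) = ∫⁻ y, ENNReal.ofReal (F y) := by
    refine setLIntegral_eq_of_support_subset fun y hy => ?_
    by_contra hy'
    exact hy (by simp [hF0 y hy'])
  refine ⟨by rw [hAF]; exact integral_nonneg hFnn, ?_, ?_⟩
  · rw [hIS, hA', ← hFr]
    exact lintegral_mono' hmeas.1 le_rfl
  · rw [hIS, hA', ← hFr]
    refine (lintegral_mono' hmeas.2 le_rfl).trans ?_
    rw [lintegral_smul_measure]
    rfl

end HarmonicBlowup

/-! ### The Green formula away from critical points -/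

namespace HarmonicBlowup

variable {n : ℕ}

lemma lintegral_omega_eq_setLIntegral (p : MvPolynomial (Fin (n + 1)) ℝ) {φ : Space n → ℝ}
    (hφ : Continuous φ) {U : Set (Space n)} (hU : MeasurableSet U) (hs : tsupport φ ⊆ U) :
    ∫⁻ x, ENNReal.ofReal (φ x) ∂(omega (polyFun p)) =
      ∫⁻ x in {x | polyFun p x = 0} ∩ U, ENNReal.ofReal (‖gradVec p x‖ * φ x) ∂μHE[n] := by
  rw [lintegral_omega p hφ.measurable.ennreal_ofReal, Set.inter_comm, ← Measure.restrict_restrict hU,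
    setLIntegral_eq_of_support_subset (s := U)]
  · refine lintegral_congr fun x => ?_
    rw [ENNReal.ofReal_mul (norm_nonneg _)]
  · intro x hx
    refine hs (subset_tsupport _ fun h0 => hx ?_)
    simp [h0]

/-- The first quotient will bound `‖∇p‖ / ⟪∇p, e⟫` near a regular point, the power the distortion of
area under projection along `e`. -/
lemma exists_small_distortion (n : ℕ) {C : ℝ} (hC : 1 < C) :
    ∃ κ : ℝ, 0 < κ ∧ κ < 1 ∧ (1 + κ) / (1 - κ) ≤ C ∧ (1 - κ)⁻¹ ^ n ≤ C := by
  have h1 : ContinuousAt (fun κ : ℝ => (1 + κ) / (1 - κ)) 0 :=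
    ContinuousAt.div (by fun_prop) (by fun_prop) (by norm_num)
  have h2 : ContinuousAt (fun κ : ℝ => (1 - κ)⁻¹ ^ n) 0 :=
    ContinuousAt.pow (ContinuousAt.inv₀ (by fun_prop) (by norm_num)) n
  have h3 := h1.eventually_lt_const (show (1 + 0) / (1 - 0) < C by norm_num; exact hC)
  have h4 := h2.eventually_lt_const (show (1 - 0 : ℝ)⁻¹ ^ n < C by norm_num; exact hC)
  have h5 : ∀ᶠ κ : ℝ in 𝓝[>] 0, κ < 1 :=
    (eventually_lt_nhds one_pos).filter_mono nhdsWithin_le_nhds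
  obtain ⟨κ, hκ⟩ := ((h3.filter_mono nhdsWithin_le_nhds).and
    ((h4.filter_mono nhdsWithin_le_nhds).and (h5.and (self_mem_nhdsWithin (a := (0 : ℝ))
      (s := Set.Ioi 0))))).exists
  exact ⟨κ, hκ.2.2.2, hκ.2.2.1, hκ.1.le, hκ.2.1.le⟩

/-- The Green formula holds near a regular point, up to a factor arbitrarily close to one. -/
lemma IsHarmonicPoly.exists_ball_compare {p : MvPolynomial (Fin (n + 1)) ℝ} (hp : IsHarmonicPoly p)
    {x₀ : Space n} (hg : gradVec p x₀ ≠ 0) {C : ℝ} (hC : 1 < C) :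
    ∃ ρ > 0, ∀ φ : Space n → ℝ, ContDiff ℝ 1 φ → HasCompactSupport φ → (∀ x, 0 ≤ φ x) →
      tsupport φ ⊆ Metric.ball x₀ ρ →
      0 ≤ halfLapAbs p φ ∧
      ENNReal.ofReal (halfLapAbs p φ) ≤
        ENNReal.ofReal C * ∫⁻ x, ENNReal.ofReal (φ x) ∂(omega (polyFun p)) ∧
      ∫⁻ x, ENNReal.ofReal (φ x) ∂(omega (polyFun p)) ≤
        ENNReal.ofReal C * ENNReal.ofReal (halfLapAbs p φ) := by
  obtain ⟨κ, hκ0, hκ1, hκC, hκn⟩ := exists_small_distortion n hC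
  obtain ⟨ρ, hρ, hnear, hpert⟩ := exists_ball_gradVec_near p hg hκ0
  refine ⟨ρ, hρ, fun φ hφ hφc hφ0 hsupp => ?_⟩
  set N := ‖gradVec p x₀‖ with hN
  set e := N⁻¹ • gradVec p x₀ with he
  have hNpos : 0 < N := norm_pos_iff.2 hg
  have he1 : ‖e‖ = 1 := by rw [he, norm_smul, norm_inv, ← hN, norm_norm, inv_mul_cancel₀ hNpos.ne']
  have hge : inner ℝ (gradVec p x₀) e = N := by
    rw [he, real_inner_smul_right, real_inner_self_eq_norm_sq, ← hN]
    field_simp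
  have hκ' : 0 < 1 - κ := sub_pos.2 hκ1
  have hlow (y) (hy : y ∈ Metric.ball x₀ ρ) : (1 - κ) * N ≤ inner ℝ (gradVec p y) e := by
    have h1 := (abs_real_inner_le_norm (gradVec p y - gradVec p x₀) e).trans_eq (by rw [he1, mul_one])
    have h2 := (abs_le.1 (h1.trans (hnear y hy))).1
    rw [inner_sub_left, hge] at h2
    linarith
  have hpos (y) (hy : y ∈ Metric.ball x₀ ρ) : 0 < inner ℝ (gradVec p y) e :=
    (mul_pos hκ' hNpos).trans_le (hlow y hy)
  have hup (y) (hy : y ∈ Metric.ball x₀ ρ) : ‖gradVec p y‖ ≤ C * inner ℝ (gradVec p y) e := by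
    have h1 := norm_le_insert' (gradVec p y) (gradVec p x₀)
    have h2 := hnear y hy
    calc ‖gradVec p y‖ ≤ (1 + κ) * N := by linarith
      _ = (1 + κ) / (1 - κ) * ((1 - κ) * N) := by field_simp
      _ ≤ C * inner ℝ (gradVec p y) e := by
        have := hlow y hy
        gcongr
  have hle (y : Space n) : inner ℝ (gradVec p y) e ≤ ‖gradVec p y‖ := by
    have := real_inner_le_norm (gradVec p y) e
    rwa [he1, mul_one] at this
  -- Chosen so that `ψ e` and `φ ∇p` have the same component along `∇p`. The denominator is positive
  -- on the ball, which contains the support of `φ`.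
  set ψ : Space n → ℝ := fun x => φ x * (‖gradVec p x‖ ^ 2 / inner ℝ (gradVec p x) e) with hψdef
  have hψs : tsupport ψ ⊆ tsupport φ := tsupport_mul_subset_left
  have hψ : ContDiff ℝ 1 ψ := by
    refine contDiff_of_contDiffAt_tsupport fun x hx => ?_
    have hxU := hsupp (hψs hx)
    exact hφ.contDiffAt.mul (((contDiff_gradVec p).norm_sq ℝ).contDiffAt.div
      ((contDiff_gradVec p).inner ℝ contDiff_const).contDiffAt (hpos x hxU).ne')
  have hψc : HasCompactSupport ψ := hφc.mul_right
  have hφout (x) (hx : x ∉ Metric.ball x₀ ρ) : φ x = 0 :=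
    image_eq_zero_of_notMem_tsupport fun h => hx (hsupp h)
  have hψ0 (x) : 0 ≤ ψ x := by
    by_cases hx : x ∈ Metric.ball x₀ ρ
    · exact mul_nonneg (hφ0 x) (div_nonneg (by positivity) (hpos x hx).le)
    · simp [hψdef, hφout x hx]
  have hA := hp.halfLapAbs_eq hφ hφc hψ hψc e (fun x => by
    by_cases hx : x ∈ Metric.ball x₀ ρ
    · have := (hpos x hx).ne'
      simp only [hψdef]
      field_simp
    · simp [hψdef, hφout x hx])
  obtain ⟨hA0, hA1, hA2⟩ := halfLap_compare p hg hκ1 hpert hψ hψc hψ0 (hψs.trans hsupp) hA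
  have hm : MeasurableSet ({x : Space n | polyFun p x = 0} ∩ Metric.ball x₀ ρ) :=
    (measurableSet_polyFun_eq_zero p).inter measurableSet_ball
  rw [lintegral_omega_eq_setLIntegral p hφ.continuous measurableSet_ball hsupp]
  refine ⟨hA0, hA1.trans ?_, le_trans ?_ (hA2.trans ?_)⟩
  · rw [← lintegral_const_mul' _ _ ENNReal.ofReal_ne_top]
    refine setLIntegral_mono' hm fun x hx => ?_
    rw [← ENNReal.ofReal_mul (by linarith)]
    refine ENNReal.ofReal_le_ofReal ?_
    have h1 := hpos x hx.2
    have h2 := hup x hx.2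
    have h3 : ‖gradVec p x‖ ^ 2 / inner ℝ (gradVec p x) e ≤ C * ‖gradVec p x‖ := by
      rw [div_le_iff₀ h1]
      nlinarith [norm_nonneg (gradVec p x)]
    calc ψ x ≤ φ x * (C * ‖gradVec p x‖) := mul_le_mul_of_nonneg_left h3 (hφ0 x)
      _ = C * (‖gradVec p x‖ * φ x) := by ring
  · refine setLIntegral_mono' hm fun x hx => ?_
    refine ENNReal.ofReal_le_ofReal ?_
    have h1 := hpos x hx.2
    have h3 : ‖gradVec p x‖ ≤ ‖gradVec p x‖ ^ 2 / inner ℝ (gradVec p x) e := by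
      rw [le_div_iff₀ h1]
      nlinarith [norm_nonneg (gradVec p x), hle x]
    rw [mul_comm]
    exact mul_le_mul_of_nonneg_left h3 (hφ0 x)
  · rw [← ENNReal.ofReal_pow (by positivity)]
    gcongr

lemma halfLapAbs_sum (p : MvPolynomial (Fin (n + 1)) ℝ) {ι : Type*} (s : Finset ι)
    {φ : ι → Space n → ℝ} (hφ : ∀ i, ContDiff ℝ 1 (φ i)) (hc : ∀ i, HasCompactSupport (φ i)) :
    halfLapAbs p (fun x => ∑ i ∈ s, φ i x) = ∑ i ∈ s, halfLapAbs p (φ i) := by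
  simp only [halfLapAbs]
  rw [← Finset.mul_sum, ← integral_finsetSum]
  · congr 2 with x
    rw [fderiv_fun_sum fun i _ => (hφ i).differentiable one_ne_zero x, ← Finset.mul_sum,
      sum_apply]
  · exact fun i _ => integrable_sign_mul p (integrable_fderiv_apply_vec (hφ i) (hc i) (by fun_prop))

/-- The Green formula for test functions supported away from the singular set. -/
lemma IsHarmonicPoly.lintegral_omega_of_regular {p : MvPolynomial (Fin (n + 1)) ℝ}
    (hp : IsHarmonicPoly p) {φ : Space n → ℝ} (hφ : ContDiff ℝ 1 φ) (hc : HasCompactSupport φ)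
    (hφ0 : ∀ x, 0 ≤ φ x) (hreg : ∀ x ∈ tsupport φ, gradVec p x ≠ 0) :
    0 ≤ halfLapAbs p φ ∧
      ∫⁻ x, ENNReal.ofReal (φ x) ∂(omega (polyFun p)) = ENNReal.ofReal (halfLapAbs p φ) := by
  -- All three statements are additive in `φ`, so gluing with a partition of unity keeps the same
  -- constant `C`, however many balls are used.
  have key (C : ℝ) (hC : 1 < C) : 0 ≤ halfLapAbs p φ ∧
      ENNReal.ofReal (halfLapAbs p φ) ≤
        ENNReal.ofReal C * ∫⁻ x, ENNReal.ofReal (φ x) ∂(omega (polyFun p)) ∧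
      ∫⁻ x, ENNReal.ofReal (φ x) ∂(omega (polyFun p)) ≤
        ENNReal.ofReal C * ENNReal.ofReal (halfLapAbs p φ) := by
    choose! ρ hρ hloc using fun x (hx : x ∈ tsupport φ) => hp.exists_ball_compare (hreg x hx) hC
    obtain ⟨t, ht, hcov⟩ := hc.isCompact.elim_nhds_subcover (fun x => Metric.ball x (ρ x))
      (fun x hx => Metric.ball_mem_nhds x (hρ x hx))
    obtain ⟨f, hf⟩ := SmoothPartitionOfUnity.exists_isSubordinate (modelWithCornersSelf ℝ (Space n))
      (isClosed_tsupport φ) (fun i : t => Metric.ball (i : Space n) (ρ i))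
      (fun i => Metric.isOpen_ball) (fun x hx => by simpa using hcov hx)
    set φ' : t → Space n → ℝ := fun i x => f i x * φ x with hφ'
    have hφ'1 (i) : ContDiff ℝ 1 (φ' i) :=
      (((f i).contMDiff.contDiff).of_le (by exact_mod_cast le_top)).mul hφ
    have hφ'c (i) : HasCompactSupport (φ' i) := hc.mul_left
    have hφ'0 (i) (x) : 0 ≤ φ' i x := mul_nonneg (f.nonneg i x) (hφ0 x)
    have hsum (x) : φ x = ∑ i, φ' i x := by
      rw [hφ', ← Finset.sum_mul]
      by_cases hx : x ∈ tsupport φ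
      · have := f.sum_eq_one hx
        rw [finsum_eq_sum_of_fintype] at this
        rw [this, one_mul]
      · rw [image_eq_zero_of_notMem_tsupport hx, mul_zero]
    have hl (i : t) := hloc i (ht i i.2) (φ' i) (hφ'1 i) (hφ'c i) (hφ'0 i)
      (tsupport_mul_subset_left.trans (hf i))
    have hA : halfLapAbs p φ = ∑ i, halfLapAbs p (φ' i) := by
      rw [← halfLapAbs_sum p _ hφ'1 hφ'c]
      congr 1
      ext x
      exact hsum x
    have hW : ∫⁻ x, ENNReal.ofReal (φ x) ∂(omega (polyFun p)) =
        ∑ i, ∫⁻ x, ENNReal.ofReal (φ' i x) ∂(omega (polyFun p)) := by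
      rw [← lintegral_finsetSum _ fun i _ => (hφ'1 i).continuous.measurable.ennreal_ofReal]
      refine lintegral_congr fun x => ?_
      rw [hsum x, ENNReal.ofReal_sum_of_nonneg fun i _ => hφ'0 i x]
    rw [hA, hW]
    refine ⟨Finset.sum_nonneg fun i _ => (hl i).1, ?_, ?_⟩
    · rw [ENNReal.ofReal_sum_of_nonneg fun i _ => (hl i).1, Finset.mul_sum]
      exact Finset.sum_le_sum fun i _ => (hl i).2.1
    · rw [ENNReal.ofReal_sum_of_nonneg fun i _ => (hl i).1, Finset.mul_sum]
      exact Finset.sum_le_sum fun i _ => (hl i).2.2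
  have hlim (a : ENNReal) (ha : a ≠ ⊤) :
      Tendsto (fun C : ℝ => ENNReal.ofReal C * a) (𝓝[>] 1) (𝓝 a) := by
    have h1 : Tendsto (fun C : ℝ => ENNReal.ofReal C) (𝓝[>] 1) (𝓝 (ENNReal.ofReal 1)) :=
      (ENNReal.continuous_ofReal.tendsto 1).mono_left nhdsWithin_le_nhds
    have := ENNReal.Tendsto.mul_const h1 (Or.inr ha)
    rwa [ENNReal.ofReal_one, one_mul] at this
  -- The upper bound comes first because it gives the finiteness used to let `C → 1` in the lower
  -- bound.
  have hW : ∫⁻ x, ENNReal.ofReal (φ x) ∂(omega (polyFun p)) ≤ ENNReal.ofReal (halfLapAbs p φ) := by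
    refine ge_of_tendsto (hlim _ ENNReal.ofReal_ne_top) ?_
    filter_upwards [self_mem_nhdsWithin] with C hC using (key C hC).2.2
  refine ⟨(key 2 one_lt_two).1, le_antisymm hW ?_⟩
  refine ge_of_tendsto (hlim _ (ne_top_of_le_ne_top ENNReal.ofReal_ne_top hW)) ?_
  filter_upwards [self_mem_nhdsWithin] with C hC using (key C hC).2.1

/-- Since `p` vanishes at the origin and is not zero, it is not constant, so some partial derivative
is a nonzero polynomial. -/
lemma IsHarmonicPoly.volume_gradVec_eq_zero {p : MvPolynomial (Fin (n + 1)) ℝ}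
    (hp : IsHarmonicPoly p) (hp0 : p ≠ 0) : volume {x | gradVec p x = 0} = 0 := by
  have hex : ∃ i, MvPolynomial.pderiv i p ≠ 0 := by
    by_contra! hall
    apply hp0
    have hconst (x : Space n) : polyFun p x = polyFun p 0 := by
      refine is_const_of_fderiv_eq_zero (𝕜 := ℝ)
        (fun x => (hasFDerivAt_polyFun p x).differentiableAt) (fun x => ?_) x 0
      have : gradVec p x = 0 := by
        ext i
        simp [hall i, polyFun]
      rw [(hasFDerivAt_polyFun p x).fderiv, this, map_zero]
    refine MvPolynomial.funext fun x => ?_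
    have := hconst (WithLp.toLp 2 x)
    rw [hp.2] at this
    simpa [polyFun] using this
  obtain ⟨i, hi⟩ := hex
  refine measure_mono_null (fun x hx => ?_) (volume_polyFun_eq_zero hi)
  have := congrArg (fun v : Space n => v i) (show gradVec p x = 0 from hx)
  simpa using this

/-- With `s = k * ‖∇p‖²`, this bound is uniform in `k` and controls the derivative of the cutoffs
near the critical set. -/
lemma exists_bound_mul_deriv_smoothTransition :
    ∃ M, ∀ s : ℝ, |s * deriv Real.smoothTransition (s - 1)| ≤ M := by
  have hcont : Continuous (deriv Real.smoothTransition) :=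
    (Real.smoothTransition.contDiff (n := 1)).continuous_deriv le_rfl
  have hcs : HasCompactSupport (deriv Real.smoothTransition) := by
    refine HasCompactSupport.intro (K := Set.Icc 0 1) isCompact_Icc fun x hx => ?_
    rw [Set.mem_Icc, not_and_or, not_le, not_le] at hx
    rcases hx with hx | hx
    · have : Real.smoothTransition =ᶠ[𝓝 x] fun _ => 0 := by
        filter_upwards [eventually_lt_nhds hx] with y hy
          using Real.smoothTransition.zero_of_nonpos hy.le
      rw [this.deriv_eq, deriv_const]
    · have : Real.smoothTransition =ᶠ[𝓝 x] fun _ => 1 := by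
        filter_upwards [eventually_gt_nhds hx] with y hy
          using Real.smoothTransition.one_of_one_le hy.le
      rw [this.deriv_eq, deriv_const]
  have hcs' : HasCompactSupport fun u : ℝ => (u + 1) * deriv Real.smoothTransition u := hcs.mul_left
  obtain ⟨M, hM⟩ := hcs'.exists_bound_of_continuous (by fun_prop)
  refine ⟨M, fun s => ?_⟩
  have := hM (s - 1)
  rwa [sub_add_cancel] at this

end HarmonicBlowup

/-! ### The Green formula across critical points -/

namespace HarmonicBlowup

variable {n : ℕ}

/-- A smooth cutoff that vanishes where `‖∇p‖² ≤ 1 / k` and equals one where `‖∇p‖² ≥ 2 / k`. -/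
noncomputable def regularCutoff (p : MvPolynomial (Fin (n + 1)) ℝ) (k : ℕ) (x : Space n) : ℝ :=
  Real.smoothTransition (k * ‖gradVec p x‖ ^ 2 - 1)

lemma contDiff_regularCutoff (p : MvPolynomial (Fin (n + 1)) ℝ) (k : ℕ) :
    ContDiff ℝ 1 (regularCutoff p k) :=
  (Real.smoothTransition.contDiff (n := 1)).comp
    ((contDiff_const.mul ((contDiff_gradVec p).norm_sq ℝ)).sub contDiff_const)

lemma tendsto_regularCutoff (p : MvPolynomial (Fin (n + 1)) ℝ) {x : Space n}
    (hx : gradVec p x ≠ 0) : ∀ᶠ k : ℕ in atTop, 2 < k * ‖gradVec p x‖ ^ 2 := by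
  have h : 0 < ‖gradVec p x‖ ^ 2 := by have := norm_pos_iff.2 hx; positivity
  exact ((tendsto_natCast_atTop_atTop (R := ℝ)).atTop_mul_const h).eventually_gt_atTop 2

lemma fderiv_regularCutoff (p : MvPolynomial (Fin (n + 1)) ℝ) (k : ℕ) (x v : Space n) :
    fderiv ℝ (regularCutoff p k) x v =
      deriv Real.smoothTransition (k * ‖gradVec p x‖ ^ 2 - 1) *
        (k * (2 * inner ℝ (gradVec p x) (fderiv ℝ (gradVec p) x v))) := by
  have h1 : HasFDerivAt (gradVec p) (fderiv ℝ (gradVec p) x) x :=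
    ((contDiff_gradVec p (m := 1)).differentiable one_ne_zero x).hasFDerivAt
  have h2 := (h1.norm_sq.const_mul (k : ℝ)).sub_const 1
  have h3 : HasDerivAt Real.smoothTransition
      (deriv Real.smoothTransition (k * ‖gradVec p x‖ ^ 2 - 1)) (k * ‖gradVec p x‖ ^ 2 - 1) :=
    ((Real.smoothTransition.contDiff (n := 1)).differentiable one_ne_zero _).hasDerivAt
  have h4 := h3.comp_hasFDerivAt x h2
  rw [show regularCutoff p k = Real.smoothTransition ∘ fun x => k * ‖gradVec p x‖ ^ 2 - 1 from rfl,
    h4.fderiv]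
  simp

/-- Differentiating `‖∇p‖²` in the direction `∇p` produces the factor `‖∇p‖²` that pays for `k`. The
bound is thus independent of `k`, and no estimate of the size of the critical set is needed. -/
lemma abs_fderiv_regularCutoff_le (p : MvPolynomial (Fin (n + 1)) ℝ) {M : ℝ}
    (hM : ∀ s : ℝ, |s * deriv Real.smoothTransition (s - 1)| ≤ M) (k : ℕ) (x : Space n) :
    |fderiv ℝ (regularCutoff p k) x (gradVec p x)| ≤ M * (2 * ‖fderiv ℝ (gradVec p) x‖) := by
  have h1 : |inner ℝ (gradVec p x) (fderiv ℝ (gradVec p) x (gradVec p x))| ≤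
      ‖fderiv ℝ (gradVec p) x‖ * ‖gradVec p x‖ ^ 2 := by
    refine (abs_real_inner_le_norm _ _).trans ?_
    have := (fderiv ℝ (gradVec p) x).le_opNorm (gradVec p x)
    nlinarith [norm_nonneg (gradVec p x)]
  rw [fderiv_regularCutoff]
  set D := deriv Real.smoothTransition (k * ‖gradVec p x‖ ^ 2 - 1) with hD
  have h2 := hM (k * ‖gradVec p x‖ ^ 2)
  rw [← hD, abs_mul, abs_of_nonneg (by positivity)] at h2
  rw [abs_mul, abs_mul, abs_mul, Nat.abs_cast, abs_two]
  calc |D| * (k * (2 * |inner ℝ (gradVec p x) (fderiv ℝ (gradVec p) x (gradVec p x))|))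
      ≤ |D| * (k * (2 * (‖fderiv ℝ (gradVec p) x‖ * ‖gradVec p x‖ ^ 2))) := by gcongr
    _ = (k * ‖gradVec p x‖ ^ 2 * |D|) * (2 * ‖fderiv ℝ (gradVec p) x‖) := by ring
    _ ≤ M * (2 * ‖fderiv ℝ (gradVec p) x‖) := by gcongr

lemma fderiv_regularCutoff_eq_zero (p : MvPolynomial (Fin (n + 1)) ℝ) {k : ℕ} {x : Space n}
    (hk : 2 < k * ‖gradVec p x‖ ^ 2) (v : Space n) : fderiv ℝ (regularCutoff p k) x v = 0 := by
  have : Real.smoothTransition =ᶠ[𝓝 (k * ‖gradVec p x‖ ^ 2 - 1)] fun _ => 1 := by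
    filter_upwards [eventually_gt_nhds (show 1 < k * ‖gradVec p x‖ ^ 2 - 1 by linarith)] with y hy
      using Real.smoothTransition.one_of_one_le hy.le
  rw [fderiv_regularCutoff, this.deriv_eq, deriv_const, zero_mul]

lemma gradVec_ne_zero_of_mem_tsupport (p : MvPolynomial (Fin (n + 1)) ℝ) (k : ℕ) {x : Space n}
    (hx : x ∈ tsupport (regularCutoff p k)) : gradVec p x ≠ 0 := by
  have hcl : IsClosed {x : Space n | 1 ≤ k * ‖gradVec p x‖ ^ 2} :=
    isClosed_le continuous_const (by fun_prop)
  have hsub : tsupport (regularCutoff p k) ⊆ {x : Space n | 1 ≤ k * ‖gradVec p x‖ ^ 2} := by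
    refine closure_minimal (fun y hy => ?_) hcl
    by_contra hlt
    exact hy (Real.smoothTransition.zero_of_nonpos (by
      have : ¬ 1 ≤ k * ‖gradVec p y‖ ^ 2 := hlt
      linarith))
  intro h0
  have h1 : 1 ≤ k * ‖gradVec p x‖ ^ 2 := hsub hx
  rw [h0] at h1
  norm_num at h1

/-- The Green formula `∫ φ dω_p = -½ ∫ sign(p) ⟪∇p, ∇φ⟫` for a harmonic polynomial `p`. -/
theorem IsHarmonicPoly.lintegral_omega_eq_halfLapAbs {p : MvPolynomial (Fin (n + 1)) ℝ}
    (hp : IsHarmonicPoly p) (hp0 : p ≠ 0) {φ : Space n → ℝ} (hφ : ContDiff ℝ 1 φ)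
    (hc : HasCompactSupport φ) (hφ0 : ∀ x, 0 ≤ φ x) :
    0 ≤ halfLapAbs p φ ∧
      ∫⁻ x, ENNReal.ofReal (φ x) ∂(omega (polyFun p)) = ENNReal.ofReal (halfLapAbs p φ) := by
  set φ' : ℕ → Space n → ℝ := fun k x => φ x * regularCutoff p k x with hφ'
  have hφ'1 (k) : ContDiff ℝ 1 (φ' k) := hφ.mul (contDiff_regularCutoff p k)
  have hreg (k) := hp.lintegral_omega_of_regular (hφ'1 k) hc.mul_right
    (fun x => mul_nonneg (hφ0 x) (Real.smoothTransition.nonneg _))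
    (fun x hx => gradVec_ne_zero_of_mem_tsupport p k (tsupport_mul_subset_right hx))
  have hae : ∀ᵐ x : Space n, gradVec p x ≠ 0 := by
    rw [ae_iff]; simpa using hp.volume_gradVec_eq_zero hp0
  -- Dominated convergence: off the null critical set the cutoff is eventually one and its
  -- derivative eventually zero.
  have hA : Tendsto (fun k => halfLapAbs p (φ' k)) atTop (𝓝 (halfLapAbs p φ)) := by
    obtain ⟨M, hM⟩ := exists_bound_mul_deriv_smoothTransition
    have hM0 : 0 ≤ M := (abs_nonneg _).trans (hM 0)
    have hDc : Continuous fun x => ‖fderiv ℝ (gradVec p) x‖ :=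
      ((contDiff_gradVec p (m := 1)).continuous_fderiv one_ne_zero).norm
    have hfd (k) (x) : fderiv ℝ (φ' k) x (gradVec p x) =
        φ x * fderiv ℝ (regularCutoff p k) x (gradVec p x) +
        regularCutoff p k x * fderiv ℝ φ x (gradVec p x) := by
      rw [hφ', fderiv_fun_mul (hφ.differentiable one_ne_zero x)
        ((contDiff_regularCutoff p k).differentiable one_ne_zero x)]
      simp
    refine Tendsto.const_mul _ (tendsto_integral_of_dominated_convergence
      (fun x => φ x * (M * (2 * ‖fderiv ℝ (gradVec p) x‖)) + |fderiv ℝ φ x (gradVec p x)|)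
      (fun k => ?_) ?_ (fun k => Eventually.of_forall fun x => ?_) ?_)
    · exact (integrable_sign_mul p (integrable_fderiv_apply_vec (hφ'1 k) hc.mul_right
        (by fun_prop))).aestronglyMeasurable
    · exact ((hφ.continuous.mul (by fun_prop)).integrable_of_hasCompactSupport hc.mul_right).add
        (integrable_fderiv_apply_vec hφ hc (by fun_prop)).abs
    · rw [norm_mul, hfd]
      refine (mul_le_of_le_one_left (norm_nonneg _) (abs_real_sign_le _)).trans ?_
      refine (norm_add_le _ _).trans ?_
      rw [norm_mul, norm_mul, Real.norm_of_nonneg (hφ0 x)]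
      gcongr
      · exact hφ0 x
      · exact abs_fderiv_regularCutoff_le p hM k x
      · refine mul_le_of_le_one_left (norm_nonneg _) ?_
        rw [regularCutoff, Real.norm_of_nonneg (Real.smoothTransition.nonneg _)]
        exact Real.smoothTransition.le_one _
    · filter_upwards [hae] with x hx
      refine tendsto_nhds_of_eventually_eq ?_
      filter_upwards [tendsto_regularCutoff p hx] with k hk
      rw [hfd, fderiv_regularCutoff_eq_zero p hk, regularCutoff,
        Real.smoothTransition.one_of_one_le (by linarith)]
      ring
  -- Monotone convergence: the cutoffs increase with `k`, and nothing is lost at critical points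
  -- because the density `‖∇p‖` vanishes there.
  have hW : Tendsto (fun k => ∫⁻ x, ENNReal.ofReal (φ' k x) ∂(omega (polyFun p))) atTop
      (𝓝 (∫⁻ x, ENNReal.ofReal (φ x) ∂(omega (polyFun p)))) := by
    have hmeas (k) : Measurable fun x => ENNReal.ofReal (φ' k x) :=
      (hφ'1 k).continuous.measurable.ennreal_ofReal
    simp_rw [lintegral_omega p (hmeas _), lintegral_omega p hφ.continuous.measurable.ennreal_ofReal]
    refine lintegral_tendsto_of_tendsto_of_monotone (fun k => ?_)
      (Eventually.of_forall fun x k l hkl => ?_) (Eventually.of_forall fun x => ?_)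
    · exact ((continuous_gradVec p).norm.measurable.ennreal_ofReal.mul (hmeas k)).aemeasurable
    · simp only [hφ', regularCutoff]
      gcongr
      · exact hφ0 x
      · refine Real.smoothTransition.monotone ?_
        gcongr
    · by_cases hx : gradVec p x = 0
      · simp [hx]
      · refine tendsto_nhds_of_eventually_eq ?_
        filter_upwards [tendsto_regularCutoff p hx] with k hk
        simp only [hφ', regularCutoff]
        rw [Real.smoothTransition.one_of_one_le (by linarith), mul_one]
  refine ⟨ge_of_tendsto' hA fun k => (hreg k).1, tendsto_nhds_unique hW ?_⟩
  simp_rw [fun k => (hreg k).2]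
  exact (ENNReal.continuous_ofReal.tendsto _).comp hA

end HarmonicBlowup

/-! ### Radial bumps and the flux profile -/

namespace HarmonicBlowup

open MvPolynomial

variable {n : ℕ}

lemma hasDerivAt_max_zero_sq (s : ℝ) : HasDerivAt (fun s : ℝ => max s 0 ^ 2) (2 * max s 0) s := by
  rcases lt_trichotomy s 0 with h | h | h
  · rw [max_eq_right h.le, mul_zero]
    refine (hasDerivAt_const s (0 : ℝ)).congr_of_eventuallyEq ?_
    filter_upwards [eventually_lt_nhds h] with y hy
    simp [max_eq_right hy.le]
  · subst h
    rw [max_self, mul_zero, hasDerivAt_iff_isLittleO_nhds_zero]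
    refine Asymptotics.IsBigO.trans_isLittleO (g := fun h : ℝ => h ^ 2) ?_ ?_
    · refine Asymptotics.IsBigO.of_bound 1 (Eventually.of_forall fun x => ?_)
      rcases le_total x 0 with hx | hx <;> simp [hx, sq_nonneg]
    · simpa using Asymptotics.isLittleO_pow_id (𝕜 := ℝ) one_lt_two
  · rw [max_eq_left h.le]
    refine ((hasDerivAt_pow 2 s).congr_of_eventuallyEq ?_).congr_deriv (by simp)
    filter_upwards [eventually_gt_nhds h] with y hy
    simp [max_eq_left hy.le]

/-- The derivative profile of `radialBump`. -/
noncomputable def radialWeight (x : Space n) : ℝ := max (1 - ‖x‖ ^ 2) 0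

/-- A radially decreasing `C¹` function with support the closed unit ball. -/
noncomputable def radialBump (x : Space n) : ℝ := radialWeight x ^ 2

lemma radialWeight_nonneg (x : Space n) : 0 ≤ radialWeight x := le_max_right _ _

lemma radialWeight_pos {x : Space n} (hx : ‖x‖ < 1) : 0 < radialWeight x :=
  lt_max_of_lt_left (by nlinarith [norm_nonneg x])

lemma radialWeight_eq_zero {x : Space n} (hx : 1 ≤ ‖x‖) : radialWeight x = 0 :=
  max_eq_right (by nlinarith)

@[fun_prop] lemma continuous_radialWeight : Continuous (radialWeight (n := n)) := by
  unfold radialWeight; fun_prop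

lemma radialBump_nonneg (x : Space n) : 0 ≤ radialBump x := sq_nonneg _

@[fun_prop] lemma continuous_radialBump : Continuous (radialBump (n := n)) := by
  unfold radialBump; fun_prop

lemma hasCompactSupport_radialWeight : HasCompactSupport (radialWeight (n := n)) :=
  HasCompactSupport.intro (isCompact_closedBall 0 1) fun x hx => radialWeight_eq_zero (by
    rw [mem_closedBall_zero_iff, not_le] at hx; exact hx.le)

lemma hasCompactSupport_radialBump : HasCompactSupport (radialBump (n := n)) := by
  unfold radialBump
  simp_rw [sq]
  exact hasCompactSupport_radialWeight.mul_left

lemma radialBump_antitone {x y : Space n} (h : ‖x‖ ≤ ‖y‖) : radialBump y ≤ radialBump x := by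
  unfold radialBump radialWeight
  gcongr

lemma hasFDerivAt_radialBump (x : Space n) :
    HasFDerivAt (radialBump (n := n)) (-(4 * radialWeight x) • innerSL ℝ x) x := by
  have h1 : HasFDerivAt (fun x : Space n => 1 - ‖x‖ ^ 2) (-(2 • innerSL ℝ x)) x :=
    (hasStrictFDerivAt_norm_sq x).hasFDerivAt.const_sub 1
  have h2 := (hasDerivAt_max_zero_sq (1 - ‖x‖ ^ 2)).comp_hasFDerivAt x h1
  refine h2.congr_fderiv ?_
  ext v
  simp [radialWeight]
  ring

/-- The bump function at scale `t`. -/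
noncomputable def scaledBump (t : ℝ) (x : Space n) : ℝ := radialBump (t⁻¹ • x)

lemma fderiv_scaledBump (t : ℝ) (x v : Space n) :
    fderiv ℝ (scaledBump t) x v = -(4 * radialWeight (t⁻¹ • x)) * (t⁻¹ * t⁻¹ * inner ℝ x v) := by
  have h1 : HasFDerivAt (fun x : Space n => t⁻¹ • x) (t⁻¹ • ContinuousLinearMap.id ℝ (Space n)) x :=
    (hasFDerivAt_id x).const_smul t⁻¹
  have h2 := (hasFDerivAt_radialBump (t⁻¹ • x)).comp x h1
  rw [show scaledBump t = radialBump ∘ fun x : Space n => t⁻¹ • x from rfl, h2.fderiv]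
  simp
  ring

lemma contDiff_radialBump : ContDiff ℝ 1 (radialBump (n := n)) := by
  rw [contDiff_one_iff_fderiv]
  refine ⟨fun x => (hasFDerivAt_radialBump x).differentiableAt, ?_⟩
  have : fderiv ℝ (radialBump (n := n)) = fun x => -(4 * radialWeight x) • innerSL ℝ x := by
    ext1 x; exact (hasFDerivAt_radialBump x).fderiv
  rw [this]
  fun_prop

lemma contDiff_scaledBump (t : ℝ) : ContDiff ℝ 1 (scaledBump (n := n) t) :=
  contDiff_radialBump.comp (by fun_prop)

lemma hasCompactSupport_scaledBump {t : ℝ} (ht : 0 < t) :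
    HasCompactSupport (scaledBump (n := n) t) :=
  hasCompactSupport_radialBump.comp_smul (inv_ne_zero ht.ne')

lemma scaledBump_nonneg (t : ℝ) (x : Space n) : 0 ≤ scaledBump t x := radialBump_nonneg _

lemma scaledBump_mono {s t : ℝ} (hs : 0 < s) (hst : s ≤ t) (x : Space n) :
    scaledBump s x ≤ scaledBump t x := by
  refine radialBump_antitone ?_
  rw [norm_smul, norm_smul]
  have ht := hs.trans_le hst
  rw [Real.norm_of_nonneg (inv_pos.2 hs).le, Real.norm_of_nonneg (inv_pos.2 ht).le]
  gcongr

lemma continuousOn_scaledBump (x : Space n) : ContinuousOn (fun t => scaledBump t x) {0}ᶜ := by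
  unfold scaledBump
  exact continuous_radialBump.comp_continuousOn
    ((continuousOn_id.inv₀ fun t ht => ht).smul continuousOn_const)

/-- The mass profile `t ↦ ∫ radialBump (x / t) dν`, a smoothed version of `t ↦ ν (B(0, t))`. -/
noncomputable def massProfile (ν : Measure (Space n)) (t : ℝ) : ℝ := ∫ x, scaledBump t x ∂ν

/-- The flux profile of `p` at scale `t`. -/
noncomputable def fluxProfile (p : MvPolynomial (Fin (n + 1)) ℝ) (t : ℝ) : ℝ :=
  ∫ z, Real.sign (polyFun p (t • z)) * (radialWeight z * inner ℝ (gradVec p (t • z)) (t • z))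

/-- Substituting `x = t z` gives the power of `t`, kept as a quotient so that `n = 0` is covered.
The factor `2` is `1/2` times the `4` in the derivative of the bump. -/
lemma halfLapAbs_scaledBump (p : MvPolynomial (Fin (n + 1)) ℝ) {t : ℝ} (ht : 0 < t) :
    halfLapAbs p (scaledBump t) = 2 * (t ^ (n + 1) / t ^ 2) * fluxProfile p t := by
  have h := Measure.integral_comp_smul (volume : Measure (Space n))
    (fun x => Real.sign (polyFun p x) * (radialWeight (t⁻¹ • x) * inner ℝ (gradVec p x) x)) t
  simp only [smul_smul, inv_mul_cancel₀ ht.ne', one_smul] at h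
  rw [finrank_euclideanSpace_fin, abs_of_pos (by positivity)] at h
  rw [fluxProfile, h, halfLapAbs, smul_eq_mul]
  have h2 : ∀ x : Space n, Real.sign (polyFun p x) * fderiv ℝ (scaledBump t) x (gradVec p x) =
      -4 * (t⁻¹ * t⁻¹) *
        (Real.sign (polyFun p x) * (radialWeight (t⁻¹ • x) * inner ℝ (gradVec p x) x)) := by
    intro x
    rw [fderiv_scaledBump, real_inner_comm]
    ring
  simp_rw [h2]
  rw [integral_const_mul]
  field_simp
  norm_num

lemma IsHarmonicPoly.massProfile_eq {p : MvPolynomial (Fin (n + 1)) ℝ}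
    (hp : IsHarmonicPoly p) (hp0 : p ≠ 0) {t : ℝ} (ht : 0 < t) :
    massProfile (omega (polyFun p)) t = 2 * (t ^ (n + 1) / t ^ 2) * fluxProfile p t := by
  have h := hp.lintegral_omega_eq_halfLapAbs hp0 (contDiff_scaledBump t)
    (hasCompactSupport_scaledBump ht) (scaledBump_nonneg t)
  rw [massProfile, integral_eq_lintegral_of_nonneg_ae (Eventually.of_forall (scaledBump_nonneg t))
    (contDiff_scaledBump t).continuous.aestronglyMeasurable, h.2, ENNReal.toReal_ofReal h.1,
    halfLapAbs_scaledBump p ht]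

lemma sign_mul_of_pos {c : ℝ} (hc : 0 < c) (r : ℝ) : Real.sign (c * r) = Real.sign r := by
  rcases lt_trichotomy r 0 with h | h | h
  · rw [Real.sign_of_neg h, Real.sign_of_neg (mul_neg_of_pos_of_neg hc h)]
  · simp [h]
  · rw [Real.sign_of_pos h, Real.sign_of_pos (mul_pos hc h)]

lemma sign_mul_self (r : ℝ) : Real.sign r * r = |r| := by
  rcases lt_trichotomy r 0 with h | h | h
  · rw [Real.sign_of_neg h, abs_of_neg h]; ring
  · simp [h]
  · rw [Real.sign_of_pos h, abs_of_pos h]; ring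

/-- Ensures that the leading coefficient of the flux profile does not vanish. -/
lemma integral_abs_polyFun_mul_radialWeight_pos {q : MvPolynomial (Fin (n + 1)) ℝ} (hq : q ≠ 0) :
    0 < ∫ z : Space n, radialWeight z * |polyFun q z| := by
  have hcont : Continuous fun z : Space n => radialWeight z * |polyFun q z| := by fun_prop
  rw [integral_pos_iff_support_of_nonneg
    (fun z => mul_nonneg (radialWeight_nonneg z) (abs_nonneg _))
    (hcont.integrable_of_hasCompactSupport hasCompactSupport_radialWeight.mul_right)]
  by_contra h0
  have h0 : volume (Function.support fun z : Space n => radialWeight z * |polyFun q z|) = 0 := by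
    simpa using h0
  have hsub : Metric.ball (0 : Space n) 1 ⊆
      (Function.support fun z : Space n => radialWeight z * |polyFun q z|) ∪
        {z | polyFun q z = 0} := by
    intro z hz
    by_cases hqz : polyFun q z = 0
    · exact Or.inr hqz
    · exact Or.inl (mul_pos (radialWeight_pos (mem_ball_zero_iff.1 hz)) (abs_pos.2 hqz)).ne'
  have := measure_mono_null hsub (measure_union_null h0 (volume_polyFun_eq_zero hq))
  exact (Metric.measure_ball_pos volume (0 : Space n) one_pos).ne' this

lemma fluxProfile_of_isHomogeneous {p : MvPolynomial (Fin (n + 1)) ℝ} {m : ℕ}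
    (hp : p.IsHomogeneous m) {t : ℝ} (ht : 0 < t) :
    fluxProfile p t = t ^ m * (m * ∫ z : Space n, radialWeight z * |polyFun p z|) := by
  rw [fluxProfile, ← integral_const_mul, ← integral_const_mul]
  congr 1 with z
  rw [inner_gradVec_of_isHomogeneous hp, polyFun_smul_of_isHomogeneous hp,
    sign_mul_of_pos (by positivity), ← sign_mul_self]
  ring

/-- If the component of degree `b` of `p` dominates along `l`, then it governs the flux profile. -/
lemma tendsto_fluxProfile (p : MvPolynomial (Fin (n + 1)) ℝ) {b : ℕ}
    (hb : homogeneousComponent b p ≠ 0) {l : Filter ℝ} [l.IsCountablyGenerated]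
    (hl : ∀ᶠ t in l, 0 < t)
    (hdom : ∀ j, j ≠ b → homogeneousComponent j p ≠ 0 →
      Tendsto (fun t : ℝ => t ^ j / t ^ b) l (𝓝 0)) :
    Tendsto (fun t => fluxProfile p t / t ^ b) l
      (𝓝 (b * ∫ z : Space n, radialWeight z * |polyFun (homogeneousComponent b p) z|)) := by
  classical
  set s := Finset.range (p.totalDegree + 1) with hs
  have hbs : b ∈ s := by
    rw [hs, Finset.mem_range, Nat.lt_succ_iff]
    by_contra h
    exact hb (homogeneousComponent_eq_zero _ _ (not_le.1 h))
  have hratio (j : ℕ) (z : Space n) : Tendsto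
      (fun t : ℝ => t ^ j / t ^ b * polyFun (homogeneousComponent j p) z) l
      (𝓝 (if j = b then polyFun (homogeneousComponent b p) z else 0)) := by
    split_ifs with hj
    · subst hj
      refine tendsto_nhds_of_eventually_eq ?_
      filter_upwards [hl] with t ht
      field_simp
    · by_cases h0 : homogeneousComponent j p = 0
      · simp [h0, polyFun, tendsto_const_nhds]
      · simpa using (hdom j hj h0).mul_const (polyFun (homogeneousComponent j p) z)
  have hbound : ∀ᶠ t in l, ∀ j ∈ s, ∀ z : Space n,
      |t ^ j / t ^ b * polyFun (homogeneousComponent j p) z| ≤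
        |polyFun (homogeneousComponent j p) z| := by
    rw [Filter.eventually_all_finset]
    intro j _
    by_cases hj : j = b
    · filter_upwards [hl] with t ht z
      subst hj
      rw [div_self (by positivity), one_mul]
    · by_cases h0 : homogeneousComponent j p = 0
      · exact Eventually.of_forall fun t z => by simp [h0, polyFun]
      · filter_upwards [hl, (hdom j hj h0).eventually_lt_const one_pos] with t ht h1 z
        rw [abs_mul, abs_of_nonneg (by positivity)]
        exact mul_le_of_le_one_left (abs_nonneg _) h1.le
  have hrw : ∀ t : ℝ, fluxProfile p t / t ^ b = ∫ z : Space n, Real.sign (polyFun p (t • z)) *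
      (radialWeight z * ∑ j ∈ s, j * (t ^ j / t ^ b * polyFun (homogeneousComponent j p) z)) := by
    intro t
    rw [fluxProfile, ← integral_div]
    congr 1 with z
    rw [inner_gradVec_smul, mul_div_assoc, mul_div_assoc, Finset.sum_div]
    congr 2
    exact Finset.sum_congr rfl fun j _ => by ring
  simp_rw [hrw]
  rw [← integral_const_mul]
  refine tendsto_integral_filter_of_dominated_convergence
    (fun z => radialWeight z * ∑ j ∈ s, j * |polyFun (homogeneousComponent j p) z|)
    (Eventually.of_forall fun t => ?_) ?_ ?_ ?_
  · refine Measurable.aestronglyMeasurable (Measurable.mul (measurable_real_sign.comp ?_) ?_) <;>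
      exact Continuous.measurable (by fun_prop)
  · filter_upwards [hbound] with t ht
    refine Eventually.of_forall fun z => ?_
    rw [norm_mul]
    refine (mul_le_of_le_one_left (norm_nonneg _) (abs_real_sign_le _)).trans ?_
    rw [norm_mul, Real.norm_of_nonneg (radialWeight_nonneg z)]
    gcongr
    · exact radialWeight_nonneg z
    · refine (norm_sum_le _ _).trans (Finset.sum_le_sum fun j hj => ?_)
      rw [norm_mul, Real.norm_natCast]
      gcongr
      exact ht j hj z
  · exact Continuous.integrable_of_hasCompactSupport (by fun_prop)
      hasCompactSupport_radialWeight.mul_right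
  · have hae : ∀ᵐ z : Space n, polyFun (homogeneousComponent b p) z ≠ 0 := by
      rw [ae_iff]; simpa using volume_polyFun_eq_zero hb
    filter_upwards [hae] with z hz
    have h1 : Tendsto (fun t : ℝ => ∑ j ∈ s, t ^ j / t ^ b * polyFun (homogeneousComponent j p) z) l
        (𝓝 (polyFun (homogeneousComponent b p) z)) := by
      have := tendsto_finsetSum s fun j _ => hratio j z
      simpa [hbs] using this
    have h2 : Tendsto (fun t : ℝ => ∑ j ∈ s, (j : ℝ) *
        (t ^ j / t ^ b * polyFun (homogeneousComponent j p) z)) l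
        (𝓝 (b * polyFun (homogeneousComponent b p) z)) := by
      have := tendsto_finsetSum s fun j _ => (hratio j z).const_mul (j : ℝ)
      simpa [hbs] using this
    -- Divided by `t ^ b`, `p (t z)` tends to its component of degree `b` at `z`; off the zero set
    -- of that component this fixes the sign.
    have h3 : ∀ᶠ t in l, Real.sign (polyFun p (t • z)) =
        Real.sign (polyFun (homogeneousComponent b p) z) := by
      have h4 : ∀ᶠ t in l, Real.sign (polyFun p (t • z)) =
          Real.sign (∑ j ∈ s, t ^ j / t ^ b * polyFun (homogeneousComponent j p) z) := by
        filter_upwards [hl] with t ht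
        rw [polyFun_smul, ← sign_mul_of_pos (inv_pos.2 (pow_pos ht b)), Finset.mul_sum]
        congr 1
        exact Finset.sum_congr rfl fun j _ => by ring
      rcases lt_or_gt_of_ne hz with h | h
      · filter_upwards [h4, h1.eventually_lt_const h] with t ht h5
        rw [ht, Real.sign_of_neg h5, Real.sign_of_neg h]
      · filter_upwards [h4, h1.eventually_const_lt h] with t ht h5
        rw [ht, Real.sign_of_pos h5, Real.sign_of_pos h]
    rw [← sign_mul_self]
    have h5 := (h2.const_mul (radialWeight z)).const_mul
      (Real.sign (polyFun (homogeneousComponent b p) z))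
    have h6 : (b : ℝ) * (radialWeight z * (Real.sign (polyFun (homogeneousComponent b p) z) *
        polyFun (homogeneousComponent b p) z)) =
        Real.sign (polyFun (homogeneousComponent b p) z) *
          (radialWeight z * (b * polyFun (homogeneousComponent b p) z)) := by ring
    rw [h6]
    refine h5.congr' ?_
    filter_upwards [h3] with t ht
    rw [ht]

end HarmonicBlowup

/-! ### Doubling ratios and the degrees of a harmonic polynomial -/

namespace HarmonicBlowup

open MvPolynomial

variable {n : ℕ}

section MassProfile

variable (ν : Measure (Space n)) [IsLocallyFiniteMeasure ν]

lemma integrable_scaledBump {t : ℝ} (ht : 0 < t) : Integrable (scaledBump t) ν :=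
  (contDiff_scaledBump t).continuous.integrable_of_hasCompactSupport (hasCompactSupport_scaledBump ht)

lemma massProfile_mono {s t : ℝ} (hs : 0 < s) (hst : s ≤ t) :
    massProfile ν s ≤ massProfile ν t :=
  integral_mono (integrable_scaledBump ν hs) (integrable_scaledBump ν (hs.trans_le hst))
    (scaledBump_mono hs hst)

lemma continuousAt_massProfile {t : ℝ} (ht : 0 < t) : ContinuousAt (massProfile ν) t := by
  refine continuousAt_of_dominated (bound := scaledBump (2 * t))
    (Eventually.of_forall fun s => (contDiff_scaledBump s).continuous.aestronglyMeasurable) ?_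
    (integrable_scaledBump ν (by linarith)) (Eventually.of_forall fun x => ?_)
  · filter_upwards [eventually_gt_nhds ht, eventually_lt_nhds (show t < 2 * t by linarith)]
      with s hs hs2
    refine Eventually.of_forall fun x => ?_
    rw [Real.norm_of_nonneg (scaledBump_nonneg s x)]
    exact scaledBump_mono hs hs2.le x
  · exact (continuousOn_scaledBump x).continuousAt (isOpen_compl_singleton.mem_nhds ht.ne')

end MassProfile

/-- The growth rate under doubling of the scale of a homogeneous harmonic polynomial of
degree `b`. -/
noncomputable def doublingRate (n b : ℕ) : ℝ := 2 ^ (n + 1) / 4 * 2 ^ b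

lemma doublingRate_pos (n b : ℕ) : 0 < doublingRate n b := by unfold doublingRate; positivity

lemma doublingRate_strictMono (n : ℕ) : StrictMono (doublingRate n) := fun a b hab => by
  unfold doublingRate
  have : (2 : ℝ) ^ a < 2 ^ b := pow_lt_pow_right₀ one_lt_two hab
  gcongr

/-- Under `t ↦ 2 * t` the prefactor `t ^ (n + 1) / t ^ 2` gains `2 ^ (n + 1) / 4` and the flux gains
`2 ^ b` in the limit, since `L` cancels. -/
lemma tendsto_massProfile_ratio {p : MvPolynomial (Fin (n + 1)) ℝ} (hp : IsHarmonicPoly p)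
    (hp0 : p ≠ 0) {b : ℕ} {L : ℝ} (hL : 0 < L) {l : Filter ℝ} (hl : ∀ᶠ t in l, 0 < t)
    (hl2 : Tendsto (fun t : ℝ => 2 * t) l l)
    (h : Tendsto (fun t => fluxProfile p t / t ^ b) l (𝓝 L)) :
    (∀ᶠ t in l, 0 < massProfile (omega (polyFun p)) t) ∧
    Tendsto (fun t => massProfile (omega (polyFun p)) (2 * t) / massProfile (omega (polyFun p)) t) l
      (𝓝 (doublingRate n b)) := by
  have hpos : ∀ᶠ t in l, 0 < fluxProfile p t := by
    filter_upwards [h.eventually_const_lt hL, hl] with t h1 ht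
    have := mul_pos h1 (pow_pos ht b)
    rwa [div_mul_cancel₀ _ (pow_pos ht b).ne'] at this
  refine ⟨?_, ?_⟩
  · filter_upwards [hpos, hl] with t h1 ht
    rw [hp.massProfile_eq hp0 ht]
    positivity
  · have h1 := ((h.comp hl2).div h hL.ne').const_mul (doublingRate n b)
    rw [div_self hL.ne', mul_one] at h1
    refine h1.congr' ?_
    filter_upwards [hpos, hl] with t h2 ht
    rw [hp.massProfile_eq hp0 ht, hp.massProfile_eq hp0 (by linarith)]
    simp only [Pi.div_apply, Function.comp_apply, doublingRate]
    field_simp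
    ring

/-- Here `h(0) = 0` enters: a component of degree zero would have flux coefficient zero and leave
the doubling ratio undetermined. -/
lemma IsHarmonicPoly.homogeneousComponent_zero {p : MvPolynomial (Fin (n + 1)) ℝ}
    (hp : IsHarmonicPoly p) : homogeneousComponent 0 p = 0 := by
  have h := hp.2
  have h2 : polyFun p 0 = coeff 0 p := by
    simp only [polyFun]
    rw [← constantCoeff_eq, ← eval_zero]
    rfl
  rw [MvPolynomial.homogeneousComponent_zero, ← h2, h, C_0]

lemma homogeneousComponent_totalDegree_ne_zero {p : MvPolynomial (Fin (n + 1)) ℝ} (hp0 : p ≠ 0) :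
    homogeneousComponent p.totalDegree p ≠ 0 := by
  obtain ⟨d, hd, hdeg⟩ := p.support.exists_mem_eq_sup
    (Finset.nonempty_iff_ne_empty.2 (by simpa using hp0)) (fun s => s.sum fun _ e => e)
  have h1 : d.degree = p.totalDegree := hdeg.symm
  intro h
  have h2 := congrArg (coeff d) h
  rw [coeff_homogeneousComponent, if_pos h1, coeff_zero] at h2
  exact mem_support_iff.1 hd h2

/-- The smallest degree of a nonzero homogeneous component. -/
noncomputable def lowDegree (p : MvPolynomial (Fin (n + 1)) ℝ) : ℕ :=
  sInf {j | homogeneousComponent j p ≠ 0}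

lemma homogeneousComponent_lowDegree_ne_zero {p : MvPolynomial (Fin (n + 1)) ℝ} (hp0 : p ≠ 0) :
    homogeneousComponent (lowDegree p) p ≠ 0 :=
  Nat.sInf_mem (s := {j | homogeneousComponent j p ≠ 0})
    ⟨_, homogeneousComponent_totalDegree_ne_zero hp0⟩

lemma lowDegree_le_totalDegree {p : MvPolynomial (Fin (n + 1)) ℝ} (hp0 : p ≠ 0) :
    lowDegree p ≤ p.totalDegree :=
  Nat.sInf_le (homogeneousComponent_totalDegree_ne_zero hp0)

lemma isHomogeneous_of_totalDegree_le_lowDegree {p : MvPolynomial (Fin (n + 1)) ℝ} {m : ℕ}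
    (h1 : m ≤ lowDegree p) (h2 : p.totalDegree ≤ m) : p.IsHomogeneous m := by
  rw [← sum_homogeneousComponent p]
  refine IsHomogeneous.sum _ _ _ fun j hj => ?_
  rw [Finset.mem_range] at hj
  by_cases h : homogeneousComponent j p = 0
  · rw [h]; exact isHomogeneous_zero _ _ _
  · have h3 : lowDegree p ≤ j := Nat.sInf_le h
    rw [show m = j by omega]
    exact homogeneousComponent_isHomogeneous j p

lemma IsHarmonicPoly.pos_of_component_ne_zero {p : MvPolynomial (Fin (n + 1)) ℝ}
    (hp : IsHarmonicPoly p) {b : ℕ} (hb : homogeneousComponent b p ≠ 0) : 0 < b := by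
  rcases Nat.eq_zero_or_pos b with rfl | h
  · exact absurd hp.homogeneousComponent_zero hb
  · exact h

lemma tendsto_pow_div_pow_atTop {j b : ℕ} (h : j < b) :
    Tendsto (fun t : ℝ => t ^ j / t ^ b) atTop (𝓝 0) := by
  refine (tendsto_pow_neg_atTop (𝕜 := ℝ) (Nat.sub_ne_zero_of_lt h)).congr' ?_
  filter_upwards [eventually_gt_atTop 0] with t ht
  rw [zpow_neg, zpow_natCast, pow_sub₀ _ ht.ne' h.le]
  field_simp

lemma tendsto_pow_div_pow_nhdsGT {j b : ℕ} (h : b < j) :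
    Tendsto (fun t : ℝ => t ^ j / t ^ b) (𝓝[>] 0) (𝓝 0) := by
  have h1 : Tendsto (fun t : ℝ => t ^ (j - b)) (𝓝[>] 0) (𝓝 0) := by
    have := ((continuous_pow (M := ℝ) (j - b)).tendsto 0).mono_left
      (nhdsWithin_le_nhds (s := Set.Ioi 0))
    rwa [zero_pow (Nat.sub_ne_zero_of_lt h)] at this
  refine h1.congr' ?_
  filter_upwards [self_mem_nhdsWithin] with t ht
  rw [pow_sub₀ _ (ne_of_gt ht) h.le]
  field_simp

lemma IsHarmonicPoly.massProfile_atTop {p : MvPolynomial (Fin (n + 1)) ℝ} (hp : IsHarmonicPoly p)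
    (hp0 : p ≠ 0) :
    (∀ᶠ t in atTop, 0 < massProfile (omega (polyFun p)) t) ∧
    Tendsto (fun t => massProfile (omega (polyFun p)) (2 * t) / massProfile (omega (polyFun p)) t)
      atTop (𝓝 (doublingRate n p.totalDegree)) := by
  have hb := homogeneousComponent_totalDegree_ne_zero hp0
  have hb0 : (0 : ℝ) < p.totalDegree := Nat.cast_pos.2 (hp.pos_of_component_ne_zero hb)
  refine tendsto_massProfile_ratio hp hp0
    (mul_pos hb0 (integral_abs_polyFun_mul_radialWeight_pos hb)) (eventually_gt_atTop 0)
    (tendsto_id.const_mul_atTop two_pos) (tendsto_fluxProfile p hb (eventually_gt_atTop 0) ?_)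
  intro j hj hj0
  refine tendsto_pow_div_pow_atTop (lt_of_le_of_ne ?_ hj)
  by_contra hlt
  exact hj0 (homogeneousComponent_eq_zero _ _ (not_le.1 hlt))

lemma IsHarmonicPoly.massProfile_nhdsGT {p : MvPolynomial (Fin (n + 1)) ℝ} (hp : IsHarmonicPoly p)
    (hp0 : p ≠ 0) :
    (∀ᶠ t in 𝓝[>] 0, 0 < massProfile (omega (polyFun p)) t) ∧
    Tendsto (fun t => massProfile (omega (polyFun p)) (2 * t) / massProfile (omega (polyFun p)) t)
      (𝓝[>] 0) (𝓝 (doublingRate n (lowDegree p))) := by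
  have hb := homogeneousComponent_lowDegree_ne_zero hp0
  have hb0 : (0 : ℝ) < lowDegree p := Nat.cast_pos.2 (hp.pos_of_component_ne_zero hb)
  have hpos : ∀ᶠ t : ℝ in 𝓝[>] 0, 0 < t := self_mem_nhdsWithin
  refine tendsto_massProfile_ratio hp hp0
    (mul_pos hb0 (integral_abs_polyFun_mul_radialWeight_pos hb)) hpos ?_
    (tendsto_fluxProfile p hb hpos ?_)
  · refine tendsto_nhdsWithin_iff.2 ⟨?_, ?_⟩
    · have : Tendsto (fun t : ℝ => 2 * t) (𝓝 0) (𝓝 (2 * 0)) := tendsto_id.const_mul 2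
      rw [mul_zero] at this
      exact this.mono_left nhdsWithin_le_nhds
    · filter_upwards [hpos] with t ht
      exact mul_pos two_pos ht
  · intro j hj hj0
    exact tendsto_pow_div_pow_nhdsGT (lt_of_le_of_ne (Nat.sInf_le hj0) hj.symm)

lemma IsHarmonicPoly.massProfile_pos {p : MvPolynomial (Fin (n + 1)) ℝ} (hp : IsHarmonicPoly p)
    (hp0 : p ≠ 0) [IsLocallyFiniteMeasure (omega (polyFun p))] {t : ℝ} (ht : 0 < t) :
    0 < massProfile (omega (polyFun p)) t := by
  obtain ⟨s, hs, hst, hs0⟩ := ((hp.massProfile_nhdsGT hp0).1.and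
    (((eventually_lt_nhds ht).filter_mono nhdsWithin_le_nhds).and
      (self_mem_nhdsWithin (a := (0 : ℝ)) (s := Set.Ioi 0)))).exists
  exact hs.trans_le (massProfile_mono _ hs0 hst.le)

lemma IsHarmonicPoly.massProfile_two_mul {p : MvPolynomial (Fin (n + 1)) ℝ} (hp : IsHarmonicPoly p)
    (hp0 : p ≠ 0) {m : ℕ} (hm : p.IsHomogeneous m) {t : ℝ} (ht : 0 < t) :
    massProfile (omega (polyFun p)) (2 * t) =
      doublingRate n m * massProfile (omega (polyFun p)) t := by
  rw [hp.massProfile_eq hp0 ht, hp.massProfile_eq hp0 (by linarith), fluxProfile_of_isHomogeneous hm ht,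
    fluxProfile_of_isHomogeneous hm (by linarith), doublingRate]
  field_simp
  ring

/-- Guarantees that a nonzero measure `ω_p` comes from a nonzero polynomial. -/
lemma omega_zero : omega (polyFun (0 : MvPolynomial (Fin (n + 1)) ℝ)) = 0 := by
  have h : ∀ x, gradVec (0 : MvPolynomial (Fin (n + 1)) ℝ) x = 0 := fun x => by
    ext i; simp [polyFun]
  rw [← Measure.measure_univ_eq_zero, ← lintegral_one, lintegral_omega _ measurable_const]
  simp [h]

end HarmonicBlowup

/-! ### Weak sequential compactness of measures -/

namespace HarmonicBlowup

variable {n : ℕ}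

/-- A continuous cutoff, equal to one on the ball of radius `R` and zero off the ball of radius
`R + 1`. -/
noncomputable def ballCutoff (R : ℝ) (x : Space n) : ℝ := max 0 (min 1 (R + 1 - ‖x‖))

lemma continuous_ballCutoff (R : ℝ) : Continuous (ballCutoff (n := n) R) := by
  unfold ballCutoff; fun_prop

lemma ballCutoff_nonneg (R : ℝ) (x : Space n) : 0 ≤ ballCutoff R x := le_max_left _ _

lemma ballCutoff_eq_one {R : ℝ} {x : Space n} (hx : ‖x‖ ≤ R) : ballCutoff R x = 1 := by
  rw [ballCutoff, min_eq_left (by linarith), max_eq_right zero_le_one]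

lemma ballCutoff_eq_zero {R : ℝ} {x : Space n} (hx : R + 1 ≤ ‖x‖) : ballCutoff R x = 0 :=
  max_eq_left ((min_le_right _ _).trans (by linarith))

lemma hasCompactSupport_ballCutoff (R : ℝ) : HasCompactSupport (ballCutoff (n := n) R) :=
  HasCompactSupport.intro (isCompact_closedBall 0 (R + 1)) fun x hx => ballCutoff_eq_zero (by
    rw [mem_closedBall_zero_iff, not_le] at hx; exact hx.le)

/-- A sequence of measures whose limits exist on all test functions converges weakly. -/
lemma exists_weakTendsto_of_tendsto (μ : ℕ → Measure (Space n)) [∀ i, IsLocallyFiniteMeasure (μ i)]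
    (h : ∀ φ : Space n → ℝ, Continuous φ → HasCompactSupport φ →
      ∃ a, Tendsto (fun i => ∫ x, φ x ∂(μ i)) atTop (𝓝 a)) :
    ∃ ν : Measure (Space n), IsLocallyFiniteMeasure ν ∧ WeakTendsto μ ν := by
  choose! Λ hΛ using h
  have hΛ' (f : CompactlySupportedContinuousMap (Space n) ℝ) :
      Tendsto (fun i => ∫ x, f x ∂(μ i)) atTop (𝓝 (Λ f)) := hΛ f f.continuous f.hasCompactSupport
  -- Linearity and positivity pass to the limit, so the Riesz–Markov–Kakutani theorem represents the
  -- limits by a measure.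
  let L : CompactlySupportedContinuousMap (Space n) ℝ →ₚ[ℝ] ℝ := PositiveLinearMap.mk₀
    { toFun := fun f => Λ f
      map_add' := fun f g => by
        refine tendsto_nhds_unique (hΛ' (f + g)) (((hΛ' f).add (hΛ' g)).congr fun i => ?_)
        exact (integral_add' f.integrable g.integrable).symm
      map_smul' := fun c f => by
        refine tendsto_nhds_unique (hΛ' (c • f)) (((hΛ' f).const_mul c).congr fun i => ?_)
        exact (integral_const_mul c _).symm }
    (fun f hf => ge_of_tendsto' (hΛ' f) fun i => integral_nonneg hf)
  refine ⟨RealRMK.rieszMeasure L, inferInstance, fun φ hφ hc => ?_⟩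
  have := RealRMK.integral_rieszMeasure L ⟨⟨φ, hφ⟩, hc⟩
  change ∫ x, φ x ∂(RealRMK.rieszMeasure L) = Λ φ at this
  rw [this]
  exact hΛ φ hφ hc

lemma cauchySeq_of_approx {u : ℕ → ℝ}
    (h : ∀ ε > 0, ∃ v : ℕ → ℝ, (∃ a, Tendsto v atTop (𝓝 a)) ∧ ∀ i, |u i - v i| ≤ ε) :
    CauchySeq u := by
  rw [Metric.cauchySeq_iff]
  intro ε hε
  obtain ⟨v, ⟨a, hv⟩, huv⟩ := h (ε / 4) (by positivity)
  obtain ⟨N, hN⟩ := Metric.cauchySeq_iff.1 hv.cauchySeq (ε / 4) (by positivity)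
  refine ⟨N, fun i hi j hj => ?_⟩
  have h1 := hN i hi j hj
  rw [Real.dist_eq] at h1 ⊢
  have h2 := abs_le.1 (huv i)
  have h3 := abs_le.1 (huv j)
  have h4 := abs_lt.1 h1
  rw [abs_lt]
  constructor <;> linarith [h2.1, h2.2, h3.1, h3.2, h4.1, h4.2]

/-- Weak sequential compactness of locally bounded sequences of measures. -/
theorem exists_subseq_weakTendsto (μ : ℕ → Measure (Space n)) [∀ i, IsLocallyFiniteMeasure (μ i)]
    (hbdd : ∀ φ : Space n → ℝ, Continuous φ → HasCompactSupport φ → (∀ x, 0 ≤ φ x) →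
      ∃ B, ∀ᶠ i in atTop, ∫ x, φ x ∂(μ i) ≤ B) :
    ∃ (σ : ℕ → ℕ) (ν : Measure (Space n)), StrictMono σ ∧ IsLocallyFiniteMeasure ν ∧
      WeakTendsto (fun i => μ (σ i)) ν := by
  have hbdd' (φ : Space n → ℝ) (hφ : Continuous φ) (hc : HasCompactSupport φ) :
      ∃ B, 0 ≤ B ∧ ∀ i, |∫ x, φ x ∂(μ i)| ≤ B := by
    obtain ⟨B, hB⟩ := hbdd (fun x => |φ x|) hφ.abs hc.norm fun x => abs_nonneg _
    have hbu : IsBoundedUnder (· ≤ ·) atTop fun i => ∫ x, |φ x| ∂(μ i) := ⟨B, by simpa using hB⟩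
    obtain ⟨B', hB'⟩ := hbu.bddAbove_range
    have h1 (i : ℕ) : |∫ x, φ x ∂(μ i)| ≤ B' :=
      
      (norm_integral_le_integral_norm (μ := μ i) φ).trans (hB' (Set.mem_range_self i))
    exact ⟨B', (abs_nonneg _).trans (h1 0), h1⟩
  -- Truncating a sequence dense for locally uniform convergence gives a countable family of test
  -- functions that suffices.
  let D := TopologicalSpace.denseSeq C(Space n, ℝ)
  let test : ℕ × ℕ → Space n → ℝ := fun k x => ballCutoff (n := n) k.1 x * D k.2 x
  have htest (k) : Continuous (test k) := (continuous_ballCutoff _).mul (D k.2).continuous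
  have htestc (k) : HasCompactSupport (test k) := (hasCompactSupport_ballCutoff _).mul_right
  choose B hB0 hB using fun k => hbdd' (test k) (htest k) (htestc k)
  -- Sequential compactness of the countable product of intervals replaces a diagonal extraction.
  obtain ⟨a, -, σ, hσ, hlim⟩ :=
    (isCompact_univ_pi fun k => isCompact_Icc (a := -B k) (b := B k)).tendsto_subseq
    (x := fun i k => ∫ x, test k x ∂(μ i)) (fun i k _ => abs_le.1 (hB k i))
  rw [tendsto_pi_nhds] at hlim
  obtain ⟨ν, hν, hw⟩ := exists_weakTendsto_of_tendsto (fun i => μ (σ i)) (fun φ hφ hc => by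
    refine cauchySeq_tendsto_of_complete (cauchySeq_of_approx fun ε hε => ?_)
    obtain ⟨N, hN⟩ : ∃ N : ℕ, ∀ x, (N : ℝ) < ‖x‖ → φ x = 0 := by
      obtain ⟨R, hR⟩ := hc.isCompact.isBounded.subset_closedBall 0
      obtain ⟨N, hN⟩ := exists_nat_ge R
      refine ⟨N, fun x hx => image_eq_zero_of_notMem_tsupport fun h => ?_⟩
      have := mem_closedBall_zero_iff.1 (hR h)
      linarith
    obtain ⟨C, hC0, hC⟩ := hbdd' _ (continuous_ballCutoff N) (hasCompactSupport_ballCutoff N)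
    obtain ⟨j, hj⟩ : ∃ j, ∀ x ∈ Metric.closedBall (0 : Space n) (N + 1),
        |φ x - D j x| < ε / (C + 1) := by
      have hcl : (⟨φ, hφ⟩ : C(Space n, ℝ)) ∈ closure (Set.range D) :=
        TopologicalSpace.denseRange_denseSeq _ _
      obtain ⟨u, hu, hlimu⟩ := mem_closure_iff_seq_limit.1 hcl
      have h1 := ContinuousMap.tendsto_iff_forall_isCompact_tendstoUniformlyOn.1 hlimu
        (Metric.closedBall 0 (N + 1)) (isCompact_closedBall _ _)
      obtain ⟨m, hm⟩ := (Metric.tendstoUniformlyOn_iff.1 h1 (ε / (C + 1)) (by positivity)).exists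
      obtain ⟨j, hj⟩ := hu m
      exact ⟨j, fun x hx => by have := hm x hx; rwa [← hj, Real.dist_eq] at this⟩
    refine ⟨fun i => ∫ x, test (N, j) x ∂(μ (σ i)), ⟨a (N, j), hlim (N, j)⟩, fun i => ?_⟩
    have hpt (x : Space n) : |φ x - test (N, j) x| ≤ ε / (C + 1) * ballCutoff N x := by
      have h1 : φ x = ballCutoff N x * φ x := by
        rcases le_or_gt ‖x‖ N with h | h
        · rw [ballCutoff_eq_one h, one_mul]
        · rw [hN x h, mul_zero]
      have h2 : φ x - test (N, j) x = ballCutoff N x * (φ x - D j x) := by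
        rw [mul_sub, ← h1]
      rw [h2, abs_mul, abs_of_nonneg (ballCutoff_nonneg _ _), mul_comm]
      rcases le_or_gt ‖x‖ (N + 1) with h | h
      · exact mul_le_mul_of_nonneg_right (hj x (mem_closedBall_zero_iff.2 h)).le
          (ballCutoff_nonneg _ _)
      · rw [ballCutoff_eq_zero h.le, mul_zero, mul_zero]
    rw [← integral_sub (hφ.integrable_of_hasCompactSupport hc)
      ((htest _).integrable_of_hasCompactSupport (htestc _))]
    calc |∫ x, (φ x - test (N, j) x) ∂(μ (σ i))|
        ≤ ∫ x, ε / (C + 1) * ballCutoff N x ∂(μ (σ i)) := by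
          refine norm_integral_le_of_norm_le (f := fun x => φ x - test (N, j) x) ?_
            (Eventually.of_forall hpt)
          exact ((continuous_ballCutoff _).integrable_of_hasCompactSupport
            (hasCompactSupport_ballCutoff _)).const_mul _
      _ = ε / (C + 1) * ∫ x, ballCutoff N x ∂(μ (σ i)) := integral_const_mul _ _
      _ ≤ ε / (C + 1) * C := by
          gcongr
          exact (le_abs_self _).trans (hC _)
      _ ≤ ε := by
          rw [div_mul_eq_mul_div, div_le_iff₀ (by positivity)]
          nlinarith)
  exact ⟨σ, ν, hσ, hν, hw⟩

end HarmonicBlowup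

/-! ### Blow-ups seen through a single monotone profile -/

namespace HarmonicBlowup

variable {n : ℕ}

lemma continuous_zoom (a : Space n) (r : ℝ) : Continuous (zoom a r) := by
  unfold zoom; fun_prop

lemma isLocallyFiniteMeasure_map_zoom (ω : Measure (Space n)) [IsLocallyFiniteMeasure ω]
    (a : Space n) {r : ℝ} (hr : 0 < r) : IsLocallyFiniteMeasure (ω.map (zoom a r)) := by
  let Z : Space n ≃ₜ Space n :=
    (Homeomorph.subRight a).trans (Homeomorph.smulOfNeZero r⁻¹ (inv_ne_zero hr.ne'))
  have hZ : zoom a r = Z := rfl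
  rw [hZ]
  have := Measure.IsFiniteMeasureOnCompacts.map ω Z
  infer_instance

lemma isLocallyFiniteMeasure_ofReal_smul (ν : Measure (Space n)) [IsLocallyFiniteMeasure ν]
    (c : ℝ) : IsLocallyFiniteMeasure (ENNReal.ofReal c • ν) :=
  inferInstanceAs (IsLocallyFiniteMeasure (c.toNNReal • ν))

/-- The mass profile of `ω` around `ξ`. -/
noncomputable def profileAt (ω : Measure (Space n)) (ξ : Space n) : ℝ → ℝ :=
  massProfile (ω.map (zoom ξ 1))

/-- All blow-ups at `ξ` are rescalings of one function, `profileAt ω ξ`, so the search for a tangent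
measure becomes a search for scales. -/
lemma massProfile_smul_map_zoom (ω : Measure (Space n)) (ξ : Space n) {c : ℝ} (hc : 0 < c)
    (r t : ℝ) :
    massProfile (ENNReal.ofReal c • ω.map (zoom ξ r)) t = c * profileAt ω ξ (t * r) := by
  rw [massProfile, integral_smul_measure, ENNReal.toReal_ofReal hc.le, profileAt, massProfile,
    integral_map (continuous_zoom ξ r).measurable.aemeasurable
      (contDiff_scaledBump t).continuous.aestronglyMeasurable,
    integral_map (continuous_zoom ξ 1).measurable.aemeasurable
      (contDiff_scaledBump _).continuous.aestronglyMeasurable, smul_eq_mul]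
  congr 2 with x
  simp only [scaledBump, zoom, inv_one, one_smul, smul_smul, mul_inv]

lemma WeakTendsto.massProfile {μ : ℕ → Measure (Space n)} {ν : Measure (Space n)}
    (h : WeakTendsto μ ν) {t : ℝ} (ht : 0 < t) :
    Tendsto (fun i => massProfile (μ i) t) atTop (𝓝 (massProfile ν t)) :=
  h _ (contDiff_scaledBump t).continuous (hasCompactSupport_scaledBump ht)

lemma exists_tendsto_profileAt {ω : Measure (Space n)} {ξ : Space n} {ν : Measure (Space n)}
    (hν : ν ∈ Tan ω ξ) : ∃ c r : ℕ → ℝ, (∀ i, 0 < c i) ∧ (∀ i, 0 < r i) ∧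
      Tendsto r atTop (𝓝 0) ∧ ∀ t > 0,
        Tendsto (fun i => c i * profileAt ω ξ (t * r i)) atTop (𝓝 (massProfile ν t)) := by
  obtain ⟨-, -, c, r, hc, hr, hr0, hw⟩ := hν
  refine ⟨c, r, hc, hr, hr0, fun t ht => ?_⟩
  simpa only [massProfile_smul_map_zoom ω ξ (hc _)] using hw.massProfile ht

/-- Pointwise convergence of monotone functions is continuous at continuity points of the limit. -/
lemma tendsto_monotone_of_tendsto {F : ℕ → ℝ → ℝ} {G : ℝ → ℝ}
    (hF : ∀ i s t, 0 < s → s ≤ t → F i s ≤ F i t)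
    (hlim : ∀ t > 0, Tendsto (fun i => F i t) atTop (𝓝 (G t))) {τ : ℝ} (hτ : 0 < τ)
    (hG : ContinuousAt G τ) {u : ℕ → ℝ} (hu : Tendsto u atTop (𝓝 τ)) :
    Tendsto (fun i => F i (u i)) atTop (𝓝 (G τ)) := by
  rw [tendsto_order]
  constructor
  · intro a ha
    have hlt : ∀ᶠ s in 𝓝[<] τ, s < τ := self_mem_nhdsWithin
    obtain ⟨s, hs1, hs2, hs3⟩ : ∃ s, a < G s ∧ s < τ ∧ 0 < s :=
      (((hG.eventually_const_lt ha).filter_mono nhdsWithin_le_nhds).and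
        (hlt.and
          ((eventually_gt_nhds hτ).filter_mono nhdsWithin_le_nhds))).exists
    filter_upwards [(hlim s hs3).eventually_const_lt hs1, hu.eventually_const_lt hs2] with i h1 h2
    exact h1.trans_le (hF i _ _ hs3 h2.le)
  · intro a ha
    have hgt : ∀ᶠ s in 𝓝[>] τ, τ < s := self_mem_nhdsWithin
    obtain ⟨s, hs1, hs2⟩ : ∃ s, G s < a ∧ τ < s :=
      (((hG.eventually_lt_const ha).filter_mono nhdsWithin_le_nhds).and
        hgt).exists
    filter_upwards [(hlim s (hτ.trans hs2)).eventually_lt_const hs1, hu.eventually_lt_const hs2,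
      hu.eventually_const_lt hτ] with i h1 h2 h3
    exact (hF i _ _ h3 h2.le).trans_lt h1

/-- The last point with `f ≥ 0` exists by compactness; `f` is negative to its right, so its value
there is also at most zero. -/
lemma exists_last_zero {f : ℝ → ℝ} {s u : ℝ} (hsu : s ≤ u) (hf : ContinuousOn f (Set.Icc s u))
    (hs : 0 < f s) (hu : f u < 0) :
    ∃ t, s ≤ t ∧ t < u ∧ f t = 0 ∧ ∀ x, t < x → x ≤ u → f x < 0 := by
  have hcl : IsClosed (Set.Icc s u ∩ f ⁻¹' Set.Ici 0) :=
    hf.preimage_isClosed_of_isClosed isClosed_Icc isClosed_Ici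
  have hcomp : IsCompact (Set.Icc s u ∩ f ⁻¹' Set.Ici 0) :=
    isCompact_Icc.of_isClosed_subset hcl Set.inter_subset_left
  obtain ⟨t, ⟨ht, ht0⟩, hmax⟩ := hcomp.exists_isGreatest ⟨s, ⟨le_rfl, hsu⟩, hs.le⟩
  have ht0 : 0 ≤ f t := ht0
  have hlt : ∀ x, t < x → x ≤ u → f x < 0 := by
    intro x hx hxu
    by_contra h
    exact absurd (hmax ⟨⟨ht.1.trans hx.le, hxu⟩, not_lt.1 h⟩) (not_le.2 hx)
  have htu : t < u := lt_of_le_of_ne ht.2 (by rintro rfl; linarith)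
  refine ⟨t, ht.1, htu, le_antisymm ?_ ht0, hlt⟩
  have hmem : Set.Ioc t u ∈ 𝓝[>] t := Ioc_mem_nhdsGT htu
  have hcont : Tendsto f (𝓝[>] t) (𝓝 (f t)) :=
    (hf t ht).mono_left (nhdsWithin_le_of_mem (mem_of_superset hmem fun x hx =>
      ⟨ht.1.trans hx.1.le, hx.2⟩))
  refine le_of_tendsto hcont ?_
  filter_upwards [hmem] with x hx using (hlt x hx.1 hx.2).le

section Profile

variable (ω : Measure (Space n)) [IsLocallyFiniteMeasure ω] (ξ : Space n)

lemma profileAt_mono {s t : ℝ} (hs : 0 < s) (hst : s ≤ t) :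
    profileAt ω ξ s ≤ profileAt ω ξ t := by
  have := isLocallyFiniteMeasure_map_zoom ω ξ one_pos
  exact massProfile_mono _ hs hst

lemma continuousAt_profileAt {t : ℝ} (ht : 0 < t) : ContinuousAt (profileAt ω ξ) t := by
  have := isLocallyFiniteMeasure_map_zoom ω ξ one_pos
  exact continuousAt_massProfile _ ht

/-- If the profile of `ω` around `ξ` doubles in a controlled way along ever longer ranges of scales
above `t i`, then the blow-ups at the scales `t i` subconverge to a tangent measure. -/
lemma exists_mem_Tan_of_doubling (hpos : ∀ t > 0, 0 < profileAt ω ξ t) {c : ℝ} (hc : 0 < c)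
    {t : ℕ → ℝ} (ht : ∀ i, 0 < t i) (ht0 : Tendsto t atTop (𝓝 0))
    (hdbl : ∀ R : ℝ, ∀ᶠ i in atTop, ∀ x, t i ≤ x → x ≤ R * t i →
      profileAt ω ξ (2 * x) ≤ c * profileAt ω ξ x) :
    ∃ ν ∈ Tan ω ξ, ∃ σ : ℕ → ℕ, StrictMono σ ∧ ∀ s > 0,
      Tendsto (fun i => profileAt ω ξ (s * t (σ i)) / profileAt ω ξ (t (σ i))) atTop
        (𝓝 (massProfile ν s)) := by
  set Φ := profileAt ω ξ with hΦ
  have hinv (i) : 0 < (Φ (t i))⁻¹ := inv_pos.2 (hpos _ (ht i))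
  set μ : ℕ → Measure (Space n) := fun i => ENNReal.ofReal (Φ (t i))⁻¹ • ω.map (zoom ξ (t i)) with hμ
  have hμf (i) : IsLocallyFiniteMeasure (μ i) := by
    have := isLocallyFiniteMeasure_map_zoom ω ξ (ht i)
    exact isLocallyFiniteMeasure_ofReal_smul _ _
  have hprof (i) (s : ℝ) : massProfile (μ i) s = Φ (s * t i) / Φ (t i) := by
    rw [hμ, massProfile_smul_map_zoom ω ξ (hinv i), div_eq_inv_mul]
  -- Iterating the doubling bound `j` times from scale `t i`, where the rescaled profile is
  -- normalized to one.
  have hpow (j : ℕ) : ∀ᶠ i in atTop, massProfile (μ i) (2 ^ j) ≤ c ^ j := by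
    filter_upwards [hdbl (2 ^ j)] with i hi
    rw [hprof, div_le_iff₀ (hpos _ (ht i))]
    have : ∀ l ≤ j, Φ (2 ^ l * t i) ≤ c ^ l * Φ (t i) := by
      intro l
      induction l with
      | zero => intro _; simp
      | succ l ih =>
        intro hl
        have h1 : (1 : ℝ) ≤ 2 ^ l := one_le_pow₀ one_le_two
        have h2 : (2 : ℝ) ^ l ≤ 2 ^ j := pow_le_pow_right₀ one_le_two (by omega)
        have h3 := hi (2 ^ l * t i) (le_mul_of_one_le_left (ht i).le h1)
          (mul_le_mul_of_nonneg_right h2 (ht i).le)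
        have h4 := ih (by omega)
        calc Φ (2 ^ (l + 1) * t i) = Φ (2 * (2 ^ l * t i)) := by congr 1; ring
          _ ≤ c * Φ (2 ^ l * t i) := h3
          _ ≤ c * (c ^ l * Φ (t i)) := by gcongr
          _ = c ^ (l + 1) * Φ (t i) := by ring
    exact this j le_rfl
  obtain ⟨σ, ν, hσ, hν, hw⟩ := exists_subseq_weakTendsto μ (fun φ hφ hφc hφ0 => by
    obtain ⟨M, hM⟩ := hφc.exists_bound_of_continuous hφ
    obtain ⟨R, hR⟩ := hφc.isCompact.isBounded.subset_closedBall 0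
    obtain ⟨j, hj⟩ := pow_unbounded_of_one_lt (2 * R) one_lt_two
    have h2j : (0 : ℝ) < 2 ^ j := by positivity
    have hM0 : 0 ≤ M := (norm_nonneg _).trans (hM 0)
    -- On the support of `φ` the rescaled norm is at most `1/2`, so the bump is at least `(3/4)² >
    -- 1/2`.
    have hpt (x : Space n) : φ x ≤ 2 * M * scaledBump (2 ^ j) x := by
      by_cases hx : x ∈ tsupport φ
      · have h1 : ‖x‖ ≤ R := mem_closedBall_zero_iff.1 (hR hx)
        have h2 : ‖((2 : ℝ) ^ j)⁻¹ • x‖ ≤ 1 / 2 := by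
          rw [norm_smul, norm_inv, Real.norm_of_nonneg h2j.le, inv_mul_le_iff₀ h2j]
          linarith
        have h3 : 3 / 4 ≤ radialWeight (((2 : ℝ) ^ j)⁻¹ • x) := by
          refine le_max_of_le_left ?_
          nlinarith [norm_nonneg (((2 : ℝ) ^ j)⁻¹ • x)]
        have h4 : 1 / 2 ≤ scaledBump (2 ^ j) x := by
          unfold scaledBump radialBump
          nlinarith
        have h5 := (le_abs_self _).trans (hM x)
        nlinarith
      · rw [image_eq_zero_of_notMem_tsupport hx]
        exact mul_nonneg (by positivity) (scaledBump_nonneg _ _)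
    refine ⟨2 * M * c ^ j, ?_⟩
    filter_upwards [hpow j] with i hi
    calc ∫ x, φ x ∂(μ i) ≤ ∫ x, 2 * M * scaledBump (2 ^ j) x ∂(μ i) :=
          integral_mono (hφ.integrable_of_hasCompactSupport hφc)
            ((integrable_scaledBump _ h2j).const_mul _) hpt
      _ = 2 * M * massProfile (μ i) (2 ^ j) := integral_const_mul _ _
      _ ≤ 2 * M * c ^ j := by gcongr)
  have hlim (s : ℝ) (hs : 0 < s) :
      Tendsto (fun i => Φ (s * t (σ i)) / Φ (t (σ i))) atTop (𝓝 (massProfile ν s)) := by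
    simpa only [hprof] using hw.massProfile hs
  refine ⟨ν, ⟨?_, hν, fun i => (Φ (t (σ i)))⁻¹, fun i => t (σ i), fun i => hinv _, fun i => ht _,
    ht0.comp hσ.tendsto_atTop, hw⟩, σ, hσ, hlim⟩
  -- The normalization `massProfile = 1` at scale one survives the limit and rules out the zero
  -- measure.
  rintro rfl
  have h1 := hlim 1 one_pos
  simp only [one_mul, div_self (hpos _ (ht _)).ne', massProfile, integral_zero_measure] at h1
  exact one_ne_zero (tendsto_nhds_unique tendsto_const_nhds h1)

end Profile

end HarmonicBlowup

/-! ### The connectedness argument -/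

namespace HarmonicBlowup

variable {n : ℕ}

/-- A strict inequality between limits already holds along the blow-ups, hence for `ω` at
arbitrarily small scales. -/
lemma exists_small_profileAt_doubling_gt {ω ν : Measure (Space n)} {ξ : Space n} (hν : ν ∈ Tan ω ξ) {c T : ℝ}
    (hT : 0 < T) (h : c * massProfile ν T < massProfile ν (2 * T)) {δ : ℝ} (hδ : 0 < δ) :
    ∃ s, 0 < s ∧ s < δ ∧ c * profileAt ω ξ s < profileAt ω ξ (2 * s) := by
  obtain ⟨a, r, ha, hr, hr0, hlim⟩ := exists_tendsto_profileAt hν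
  have h0 : Tendsto (fun i => T * r i) atTop (𝓝 0) := by simpa using hr0.const_mul T
  obtain ⟨i, hi, hit⟩ := ((((hlim T hT).const_mul c).eventually_lt (hlim (2 * T) (by linarith))
    h).and (h0.eventually_lt_const hδ)).exists
  refine ⟨T * r i, mul_pos hT (hr i), hit, ?_⟩
  rw [mul_left_comm, mul_assoc 2] at hi
  exact lt_of_mul_lt_mul_left hi (ha i).le

section Profile

variable {ω : Measure (Space n)} [IsLocallyFiniteMeasure ω] {ξ : Space n}

lemma profileAt_pos {ν : Measure (Space n)} (hν : ν ∈ Tan ω ξ) (h1 : 0 < massProfile ν 1)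
    {t : ℝ} (ht : 0 < t) : 0 < profileAt ω ξ t := by
  obtain ⟨c, r, hc, hr, hr0, hlim⟩ := exists_tendsto_profileAt hν
  obtain ⟨i, hi, hit⟩ :=
    (((hlim 1 one_pos).eventually_const_lt h1).and (hr0.eventually_lt_const ht)).exists
  rw [one_mul] at hi
  exact (pos_of_mul_pos_right hi (hc i).le).trans_le (profileAt_mono ω ξ (hr i) hit.le)

/-- If one tangent measure has small-scale doubling below `c` and another one has some doubling
above `c`, then there is a tangent measure whose doubling is exactly `c` at scale one and at most
`c` at all larger scales. -/
lemma exists_mem_Tan_doubling_eq (hpos : ∀ t > 0, 0 < profileAt ω ξ t) {ν₀ ν₁ : Measure (Space n)}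
    (hν₀ : ν₀ ∈ Tan ω ξ) (hν₁ : ν₁ ∈ Tan ω ξ) {c t₀ T : ℝ} (hc : 0 < c) (ht₀ : 0 < t₀)
    (h₀ : ∀ t, 0 < t → t ≤ t₀ → massProfile ν₀ (2 * t) < c * massProfile ν₀ t)
    (hT : 0 < T) (h₁ : c * massProfile ν₁ T < massProfile ν₁ (2 * T)) :
    ∃ ν ∈ Tan ω ξ, massProfile ν 1 = 1 ∧ massProfile ν 2 = c ∧
      ∀ s, 1 ≤ s → massProfile ν (2 * s) ≤ c * massProfile ν s := by
  obtain ⟨a, r, ha, hr, hr0, hlim⟩ := exists_tendsto_profileAt hν₀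
  have := hν₀.2.1
  set D : ℝ → ℝ := fun t => profileAt ω ξ (2 * t) - c * profileAt ω ξ t with hD
  have hDcont {s : ℝ} (hs : 0 < s) : ContinuousAt D s := by
    refine ContinuousAt.sub ?_ (continuousAt_const.mul (continuousAt_profileAt ω ξ hs))
    exact ContinuousAt.comp (g := profileAt ω ξ) (f := fun t => 2 * t)
      (continuousAt_profileAt ω ξ (by linarith)) (by fun_prop)
  have hev : ∀ᶠ i in atTop, D (t₀ * r i) < 0 := by
    filter_upwards [(hlim (2 * t₀) (by linarith)).eventually_lt ((hlim t₀ ht₀).const_mul c)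
      (h₀ t₀ ht₀ le_rfl)] with i hi
    rw [mul_left_comm, mul_assoc 2] at hi
    exact sub_neg.2 (lt_of_mul_lt_mul_left hi (ha i).le)
  -- The last crossing of ratio `c` below `t₀ * r i`. The default `1` is used only where `D (t₀ * r
  -- i) ≥ 0`, which fails eventually.
  have hex (i : ℕ) : ∃ t, 0 < t ∧ (D (t₀ * r i) < 0 →
      t < t₀ * r i ∧ D t = 0 ∧ ∀ x, t < x → x ≤ t₀ * r i → D x < 0) := by
    by_cases hi : D (t₀ * r i) < 0
    · obtain ⟨s, hs0, hs, hDs⟩ :=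
        exists_small_profileAt_doubling_gt hν₁ hT h₁ (mul_pos ht₀ (hr i))
      obtain ⟨t, hst, ht⟩ := exists_last_zero (f := D) hs.le
        (fun x hx => (hDcont (hs0.trans_le hx.1)).continuousWithinAt) (sub_pos.2 hDs) hi
      exact ⟨t, hs0.trans_le hst, fun _ => ht⟩
    · exact ⟨1, one_pos, fun h => absurd h hi⟩
  choose t ht hDt using hex
  -- A positive subsequential limit `τ ≤ t₀` would be a scale at which `ν₀` has doubling exactly
  -- `c`, against `h₀`.
  have hu : Tendsto (fun i => t i / r i) atTop (𝓝 0) := by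
    refine tendsto_of_subseq_tendsto fun ns hns => ?_
    have hmem : ∀ᶠ i in atTop, t (ns i) / r (ns i) ∈ Set.Icc 0 t₀ := by
      filter_upwards [hns.eventually hev] with i hi
      exact ⟨(div_pos (ht _) (hr _)).le, ((div_lt_iff₀ (hr _)).2 (hDt _ hi).1).le⟩
    obtain ⟨τ, hτ, φ, hφ, hlimτ⟩ := isCompact_Icc.tendsto_subseq' hmem.frequently
    refine ⟨φ, ?_⟩
    rcases hτ.1.eq_or_lt with h | hτ0
    · rw [h]; exact hlimτ
    exfalso
    have hms : Tendsto (fun i => ns (φ i)) atTop atTop := hns.comp hφ.tendsto_atTop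
    have hmono (i : ℕ) (s u : ℝ) (hs : 0 < s) (hsu : s ≤ u) :
        a (ns (φ i)) * profileAt ω ξ (s * r (ns (φ i))) ≤
          a (ns (φ i)) * profileAt ω ξ (u * r (ns (φ i))) :=
      mul_le_mul_of_nonneg_left (profileAt_mono ω ξ (mul_pos hs (hr _))
        (mul_le_mul_of_nonneg_right hsu (hr _).le)) (ha _).le
    have hl1 := tendsto_monotone_of_tendsto hmono (fun s hs => (hlim s hs).comp hms) hτ0
      (continuousAt_massProfile ν₀ hτ0) hlimτ
    have hl2 := tendsto_monotone_of_tendsto hmono (fun s hs => (hlim s hs).comp hms)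
      (mul_pos two_pos hτ0) (continuousAt_massProfile ν₀ (mul_pos two_pos hτ0))
      (hlimτ.const_mul 2)
    refine (h₀ τ hτ0 hτ.2).ne (tendsto_nhds_unique hl2 ((hl1.const_mul c).congr' ?_))
    filter_upwards [hms.eventually hev] with i hi
    have hz := (hDt _ hi).2.1
    simp only [hD, sub_eq_zero] at hz
    simp only [Function.comp_apply]
    rw [mul_assoc 2, div_mul_cancel₀ _ (hr _).ne', hz]
    ring
  have htr (i) : t i / r i * r i = t i := div_mul_cancel₀ _ (hr i).ne'
  have ht0 : Tendsto t atTop (𝓝 0) := by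
    simpa only [htr, mul_zero] using hu.mul hr0
  -- As `t i / r i → 0`, the range up to `R * t i` eventually stays below `t₀ * r i`, where `D` is
  -- negative after the last crossing.
  have hdbl (R : ℝ) : ∀ᶠ i in atTop, ∀ x, t i ≤ x → x ≤ R * t i →
      profileAt ω ξ (2 * x) ≤ c * profileAt ω ξ x := by
    have hR : Tendsto (fun i => R * (t i / r i)) atTop (𝓝 0) := by simpa using hu.const_mul R
    filter_upwards [hev, hR.eventually_lt_const ht₀] with i hi hRi x hx hxR
    obtain ⟨-, hz, hneg⟩ := hDt i hi
    rcases hx.eq_or_lt with rfl | hx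
    · exact (sub_eq_zero.1 hz).le
    · refine (sub_neg.1 (hneg x hx (hxR.trans ?_))).le
      rw [← htr i, ← mul_assoc]
      exact mul_le_mul_of_nonneg_right hRi.le (hr i).le
  obtain ⟨ν, hν, σ, hσ, hlimν⟩ := exists_mem_Tan_of_doubling ω ξ hpos hc ht ht0 hdbl
  refine ⟨ν, hν, ?_, ?_, fun s hs => ?_⟩
  · refine tendsto_nhds_unique (hlimν 1 one_pos) (tendsto_const_nhds.congr fun i => ?_)
    rw [one_mul, div_self (hpos _ (ht _)).ne']
  · refine tendsto_nhds_unique (hlimν 2 two_pos) (tendsto_const_nhds.congr' ?_)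
    filter_upwards [hσ.tendsto_atTop.eventually hev] with i hi
    rw [eq_div_iff (hpos _ (ht _)).ne']
    exact (sub_eq_zero.1 (hDt _ hi).2.1).symm
  · refine le_of_tendsto_of_tendsto (hlimν (2 * s) (by linarith))
      ((hlimν s (by linarith)).const_mul c) ?_
    filter_upwards [hσ.tendsto_atTop.eventually (hdbl s)] with i hi
    rw [← mul_div_assoc, div_le_div_iff_of_pos_right (hpos _ (ht _)), mul_assoc]
    exact hi _ (le_mul_of_one_le_left (ht _).le hs) le_rfl

end Profile

lemma exists_ne_zero_of_mem_Tan {ω : Measure (Space n)} {ξ : Space n} {k : ℕ}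
    (hTan : Tan ω ξ ⊆ PolyCone n k) {ν : Measure (Space n)} (hν : ν ∈ Tan ω ξ) :
    ∃ p : MvPolynomial (Fin (n + 1)) ℝ, IsHarmonicPoly p ∧ p ≠ 0 ∧ p.totalDegree ≤ k ∧
      ν = omega (polyFun p) := by
  obtain ⟨p, hp, hpk, rfl⟩ := hTan hν
  refine ⟨p, hp, ?_, hpk, rfl⟩
  rintro rfl
  exact hν.1 omega_zero

section Cone

variable {ω : Measure (Space n)} [IsLocallyFiniteMeasure ω] {ξ : Space n} {k : ℕ}

/-- A larger total degree would force some tangent measure to have a doubling ratio strictly between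
two consecutive rates, although minimality of `lowDegree p₀` makes that measure homogeneous. -/
lemma totalDegree_le_of_lowDegree_minimal (hTan : Tan ω ξ ⊆ PolyCone n k)
    {p₀ p₁ : MvPolynomial (Fin (n + 1)) ℝ} (hp₀ : IsHarmonicPoly p₀) (h₀ : p₀ ≠ 0)
    (hT₀ : omega (polyFun p₀) ∈ Tan ω ξ)
    (hmin : ∀ p : MvPolynomial (Fin (n + 1)) ℝ, IsHarmonicPoly p → p ≠ 0 → p.totalDegree ≤ k →
      omega (polyFun p) ∈ Tan ω ξ → lowDegree p₀ ≤ lowDegree p)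
    (hp₁ : IsHarmonicPoly p₁) (h₁ : p₁ ≠ 0) (hT₁ : omega (polyFun p₁) ∈ Tan ω ξ) :
    p₁.totalDegree ≤ lowDegree p₀ := by
  by_contra! hlt
  set m := lowDegree p₀
  obtain ⟨c, hmc, hcm⟩ := exists_between (doublingRate_strictMono n (Nat.lt_succ_self m))
  have hc : 0 < c := (doublingRate_pos n m).trans hmc
  have := hT₀.2.1
  have hpos (t : ℝ) (ht : 0 < t) : 0 < profileAt ω ξ t :=
    profileAt_pos hT₀ (hp₀.massProfile_pos h₀ one_pos) ht
  obtain ⟨T, hTpos, hTr, hT⟩ := ((hp₁.massProfile_atTop h₁).1.and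
    (((hp₁.massProfile_atTop h₁).2.eventually_const_lt
      (hcm.trans_le ((doublingRate_strictMono n).monotone hlt))).and (eventually_gt_atTop 0))).exists
  rw [lt_div_iff₀ hTpos] at hTr
  obtain ⟨ε, hε, hsmall⟩ := mem_nhdsGT_iff_exists_Ioc_subset.1
    ((hp₀.massProfile_nhdsGT h₀).2.eventually_lt_const hmc)
  have hε : 0 < ε := hε
  obtain ⟨ν, hν, hν1, hν2, hνs⟩ := exists_mem_Tan_doubling_eq hpos hT₀ hT₁ hc hε
    (fun t ht htε => (div_lt_iff₀ (hp₀.massProfile_pos h₀ ht)).1 (hsmall ⟨ht, htε⟩)) hT hTr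
  obtain ⟨p, hp, hp0, hpk, rfl⟩ := exists_ne_zero_of_mem_Tan hTan hν
  -- The ratio is at most `c` at all scales above one, hence so is its limit at infinity, and `c`
  -- lies below the rate of `m + 1`.
  have hdeg : p.totalDegree ≤ m := by
    have hle : doublingRate n p.totalDegree ≤ c := by
      refine le_of_tendsto (hp.massProfile_atTop hp0).2 ?_
      filter_upwards [eventually_ge_atTop 1, (hp.massProfile_atTop hp0).1] with s hs hs0
      exact (div_le_iff₀ hs0).2 (hνs s hs)
    exact Nat.lt_succ_iff.1 ((doublingRate_strictMono n).lt_iff_lt.1 (hle.trans_lt hcm))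
  -- The lowest degree is at least `m` and the total degree at most `m`, so `p` is homogeneous and
  -- its ratio at scale one is the rate of `m` instead of `c`.
  have h2 := hp.massProfile_two_mul hp0
    (isHomogeneous_of_totalDegree_le_lowDegree (hmin p hp hp0 hpk hν) hdeg) one_pos
  rw [mul_one, hν1, hν2, mul_one] at h2
  exact hmc.ne' h2

lemma exists_Tan_subset_HomogCone (hTan : Tan ω ξ ⊆ PolyCone n k) :
    ∃ m ≤ k, Tan ω ξ ⊆ HomogCone n m := by
  rcases (Tan ω ξ).eq_empty_or_nonempty with he | ⟨ν, hν⟩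
  · exact ⟨0, k.zero_le, he ▸ Set.empty_subset _⟩
  let S : Set (MvPolynomial (Fin (n + 1)) ℝ) :=
    {p | IsHarmonicPoly p ∧ p ≠ 0 ∧ p.totalDegree ≤ k ∧ omega (polyFun p) ∈ Tan ω ξ}
  have hS : (lowDegree '' S).Nonempty := by
    obtain ⟨p, hp, hp0, hpk, rfl⟩ := exists_ne_zero_of_mem_Tan hTan hν
    exact ⟨_, p, ⟨hp, hp0, hpk, hν⟩, rfl⟩
  obtain ⟨p₀, ⟨hp₀, h₀, hk₀, hT₀⟩, hmin₀⟩ := Nat.sInf_mem hS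
  have hlow (p : MvPolynomial (Fin (n + 1)) ℝ) (hp : IsHarmonicPoly p) (hp0 : p ≠ 0)
      (hpk : p.totalDegree ≤ k) (hT : omega (polyFun p) ∈ Tan ω ξ) :
      lowDegree p₀ ≤ lowDegree p :=
    hmin₀ ▸ Nat.sInf_le ⟨p, ⟨hp, hp0, hpk, hT⟩, rfl⟩
  refine ⟨lowDegree p₀, (lowDegree_le_totalDegree h₀).trans hk₀, fun ν hν => ?_⟩
  obtain ⟨p, hp, hp0, hpk, rfl⟩ := exists_ne_zero_of_mem_Tan hTan hν
  exact ⟨p, hp, isHomogeneous_of_totalDegree_le_lowDegree (hlow p hp hp0 hpk hν)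
    (totalDegree_le_of_lowDegree_minimal hTan hp₀ h₀ hT₀ hlow hp hp0 hν), rfl⟩

/-- The degree can be recovered from the measure alone: the doubling at scale one is the rate, which
is injective in the degree. -/
lemma eq_of_mem_HomogCone {ν : Measure (Space n)} [IsLocallyFiniteMeasure ν] (hν : ν ≠ 0)
    {m l : ℕ} (hm : ν ∈ HomogCone n m) (hl : ν ∈ HomogCone n l) : m = l := by
  obtain ⟨p, hp, hpm, rfl⟩ := hm
  obtain ⟨q, hq, hql, hpq⟩ := hl
  have hp0 : p ≠ 0 := by rintro rfl; exact hν omega_zero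
  have hq0 : q ≠ 0 := by rintro rfl; exact hν (hpq.trans omega_zero)
  have h1 := hp.massProfile_two_mul hp0 hpm one_pos
  have h2 := hq.massProfile_two_mul hq0 hql one_pos
  rw [← hpq, h1] at h2
  exact (doublingRate_strictMono n).injective
    (mul_right_cancel₀ (hp.massProfile_pos hp0 one_pos).ne' h2)

end Cone

end HarmonicBlowup

theorem propositionp (n : ℕ) (ω : MeasureTheory.Measure (HarmonicBlowup.Space n))
    [MeasureTheory.IsLocallyFiniteMeasure ω] (ξ : HarmonicBlowup.Space n) (k : ℕ)
    (hTan : HarmonicBlowup.Tan ω ξ ⊆ HarmonicBlowup.PolyCone n k) :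
    (∀ m : ℕ, (HarmonicBlowup.Tan ω ξ ∩ HarmonicBlowup.HomogCone n m).Nonempty →
      HarmonicBlowup.Tan ω ξ ⊆ HarmonicBlowup.HomogCone n m) ∧
    (∃ m : ℕ, m ≤ k ∧ HarmonicBlowup.Tan ω ξ ⊆ HarmonicBlowup.HomogCone n m) := by
  obtain ⟨l, hlk, hl⟩ := HarmonicBlowup.exists_Tan_subset_HomogCone hTan
  refine ⟨?_, l, hlk, hl⟩
  rintro m ⟨ν, hν, hm⟩
  have := hν.2.1
  rwa [HarmonicBlowup.eq_of_mem_HomogCone hν.1 hm (hl hν)]
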